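/- Let $I\subset\mathbb R$ be an interval with more than one point, let $S^2$ be the unit sphere with round metric $\sigma_{AB}$, area form $\epsilon_{AB}$ (outward orientation) and Levi-Civita connection $\nabla$, and let $\tilde X^1,\tilde X^2,\tilde X^3$ be the restrictions of the Cartesian coordinates; $\epsilon^{ijk}$ is the Levi-Civita symbol. Let $(m,N_A,C_{AB})$ be smooth null infinity data on $I\times S^2$ in Bondi–Sachs coordinates: a mass aspect function $m$, an angular momentum aspect one-form $N_A$, and a symmetric traceless shear tensor $C_{AB}$ with news $N_{AB}=\partial_uC_{AB}$, satisfying the vacuum Einstein equations at null infinity $$\partial_u m=-\tfrac18N_{AB}N^{AB}+\tfrac14\nabla^A\nabla^BN_{AB},$$ $$\partial_uN_A=\nabla_Am-\tfrac14\nabla^D(\nabla_D\nabla^EC_{EA}-\nabla_A\nabla^EC_{ED})+\tfrac14\nabla_A(C_{BE}N^{BE})-\tfrac14\nabla_B(C^{BD}N_{DA})+\tfrac12C_{AB}\nabla_DN^{DB}.$$ Suppose the potentials of the shear are $\ell=2$ harmonics: $C_{AB}=\nabla_A\nabla_Bc-\frac12\sigma_{AB}\Delta c+\frac12(\epsilon_A{}^E\nabla_E\nabla_B\underline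 c+\epsilon_B{}^E\nabla_E\nabla_A\underline c)$ with $c=\sum c_{ij}(u)\tilde X^i\tilde X^j$, $\underline c=\sum\underline c_{ij}(u)\tilde X^i\tilde X^j$, where $c_{ij},\underline c_{ij}$ are symmetric and traceless, and put $n_{ij}=\partial_uc_{ij}$, $\underline n_{ij}=\partial_u\underline c_{ij}$. Let $\hat m=m-\frac14\nabla^A\nabla^BC_{AB}$ and let $\sum\hat m_{kl}(u)\tilde X^k\tilde X^l$ ($\hat m_{kl}$ symmetric and traceless) be the $\ell=2$ mode of $\hat m$. Define $$E=\int_{S^2}2m,\qquad P^k=\int_{S^2}2m\tilde X^k,\qquad \tilde J^k=\int_{S^2}\epsilon^{AB}\nabla_B\tilde X^k\big[N_A-\tfrac14C_A{}^D\nabla^BC_{DB}\big],$$ $$\tilde C^k=\int_{S^2}\nabla^A\tilde X^k\big[N_A-u\nabla_Am-\tfrac14C_A{}^D\nabla^BC_{DB}-\tfrac1{16}\nabla_A(C_{DE}C^{DE})\big],$$ $$J^k=\tilde J^k-\int_{S^2}\epsilon^{AB}\nabla_B\tilde X^k\,c\,\nabla_Am,\qquad C^k=\tilde C^k-2\int_{S^2}\nabla^A\tilde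 X^k\,\underline c\,\epsilon_{AB}\nabla^Bm$$ ($J^k$ is the Chen–Wang–Yau angular momentum, $C^k$ the quadrupole form of the Chen–Wang–Yau center of mass). Then on $I$ (with one-sided derivatives at end points belonging to $I$), for $k,l=1,2,3$, $$\partial_uE=-\tfrac{8\pi}5\sum_{i,j}(n_{ij}^2+\underline n_{ij}^2),\qquad \partial_uP^k=-\tfrac{32\pi}{15}\sum_{i,j,p}n_{ij}\underline n_{jp}\epsilon^{ipk},$$ $$\partial_u\tilde J^k=\tfrac{16\pi}5\sum_{i,j,p}(c_{ij}n_{jp}+\underline c_{ij}\underline n_{jp})\epsilon^{ipk},\qquad \partial_u\tilde C^k=\tfrac{32u\pi}{15}\sum_{i,j,p}n_{ij}\underline n_{jp}\epsilon^{ipk},$$ $$\partial_u\hat m_{kl}=\tfrac67\Big[\sum_i(n_{ik}n_{il}+\underline n_{ik}\underline n_{il})-\tfrac13\delta_{kl}\sum_{i,j}(n_{ij}^2+\underline n_{ij}^2)\Big],$$ $$\partial_uJ^k=\tfrac{16\pi}{15}\sum_{i,j,p}\big(3c_{ij}n_{jp}+3\underline c_{ij}\underline n_{jp}-n_{ij}\hat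 m_{jp}-c_{ij}\,\partial_u\hat m_{jp}\big)\epsilon^{ipk},$$ $$\partial_uC^k=\tfrac{16\pi}{15}\sum_{i,j,p}\big(2\underline n_{ij}\hat m_{jp}+2\underline c_{ij}\,\partial_u\hat m_{jp}+6\underline n_{ij}c_{jp}+6\underline c_{ij}n_{jp}\big)\epsilon^{ipk}+\tfrac{32u\pi}{15}\sum_{i,j,p}n_{ij}\underline n_{jp}\epsilon^{ipk}.$$ Moreover, the Chen–Wang–Yau center of mass for general potentials, $$C^k_{\rm gen}=\tilde C^k+\int_{S^2}\nabla^A\tilde X^k\big(-c\nabla_Am+2\epsilon_{AB}(\nabla^B\underline c)m\big)+\int_{S^2}\big(3\tilde X^kcm-\tfrac14\tilde X^k\nabla_A\underline F^{AB}\nabla^D\underline F_{DB}\big),$$ where $\underline F_{AB}=\frac12(\epsilon_A{}^E\nabla_E\nabla_B\underline c+\epsilon_B{}^E\nabla_E\nabla_A\underline c)$, is related to $C^k$ by $C^k_{\rm gen}=C^k+\sum_jc_{kj}P^j-\int_{S^2}\tilde X^k\,c\,m$. -/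

import Mathlib

open MeasureTheory Set
open scoped ContDiff

noncomputable section

namespace NullInfinity

/-- Euclidean three-space. -/
abbrev E3 : Type := EuclideanSpace ℝ (Fin 3)

/-- The unit sphere `S²` in Euclidean three-space. -/
abbrev S2 : Type := Metric.sphere (0 : E3) 1

/-- The area measure of the round unit sphere (total mass `4π`). -/
def area : Measure S2 := (volume : Measure E3).toSphere

/-- The restriction to `S²` of the standard coordinate function `k`. -/
def X (k : Fin 3) (x : S2) : ℝ := (x : E3) k

/-- The Levi-Civita symbol in three dimensions. -/
def leviCivita (i j k : Fin 3) : ℝ :=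
  (((j : ℕ) : ℝ) - ((i : ℕ) : ℝ)) * (((k : ℕ) : ℝ) - ((i : ℕ) : ℝ)) *
    (((k : ℕ) : ℝ) - ((j : ℕ) : ℝ)) / 2

/-- The Kronecker symbol. -/
def delta (i j : Fin 3) : ℝ := if i = j then 1 else 0

/-!
### Tensor calculus on the round sphere

Tensor fields on `S²` are written in the ambient Cartesian frame: a one-form is a field of vectors
`w a` with `∑ a, w a * X a = 0`, and a covariant 2-tensor is a field of arrays `T a b` each of whose
slots is annihilated by the position vector.  Contraction with the round metric is then contraction
over the ambient indices, and indices need not be distinguished as upper or lower.  The Levi-Civita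
connection of the induced metric is the tangential projection of the ambient derivative, which is
computed on the extension that is constant along rays.
-/

theorem norm_normalize {y : E3} (h : y ≠ 0) : ‖y‖⁻¹ • y ∈ Metric.sphere (0 : E3) 1 := by
  simp [norm_smul, h]

open Classical in
/-- The extension of a field on `S²` to `ℝ³ ∖ {0}` which is constant along rays
(with junk value `0` at the origin). -/
def radialExt {V : Type} [Zero V] (f : S2 → V) (y : E3) : V :=
  if h : y = 0 then 0 else f ⟨‖y‖⁻¹ • y, norm_normalize h⟩

/-- The derivative at `x ∈ S²` in the ambient direction `a` of the radially constant extension: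
the `a`-th Cartesian component of the surface gradient of `f`. -/
def partialDeriv (a : Fin 3) (f : S2 → ℝ) (x : S2) : ℝ :=
  fderiv ℝ (radialExt f) (x : E3) (EuclideanSpace.single a 1)

/-- The round metric `σ`, which is also the orthogonal projection onto the tangent plane. -/
def sigma (x : S2) (a b : Fin 3) : ℝ := delta a b - X a x * X b x

/-- The area form `ε` (oriented by the outward normal). -/
def epsilon (x : S2) (a b : Fin 3) : ℝ := ∑ c, leviCivita a b c * X c x

/-- `∇_a f` for a function. -/
def grad (f : S2 → ℝ) (x : S2) (a : Fin 3) : ℝ := partialDeriv a f x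

/-- `∇_a w_b` for a one-form. -/
def covDeriv1 (w : S2 → Fin 3 → ℝ) (x : S2) (a b : Fin 3) : ℝ :=
  ∑ b', sigma x b b' * partialDeriv a (fun y => w y b') x

/-- `∇_a T_{bc}` for a 2-tensor. -/
def covDeriv2 (T : S2 → Fin 3 → Fin 3 → ℝ) (x : S2) (a b c : Fin 3) : ℝ :=
  ∑ b', ∑ c', sigma x b b' * sigma x c c' * partialDeriv a (fun y => T y b' c') x

/-- `∇_a ∇_b f`. -/
def hess (f : S2 → ℝ) : S2 → Fin 3 → Fin 3 → ℝ := covDeriv1 (grad f)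

/-- The Laplace-Beltrami operator. -/
def laplacian (f : S2 → ℝ) (x : S2) : ℝ := ∑ a, hess f x a a

/-- `∇^a w_a`. -/
def div1 (w : S2 → Fin 3 → ℝ) (x : S2) : ℝ := ∑ a, covDeriv1 w x a a

/-- `∇^a T_{ab}`. -/
def div2 (T : S2 → Fin 3 → Fin 3 → ℝ) (x : S2) (b : Fin 3) : ℝ := ∑ a, covDeriv2 T x a a b

/-- `S_{ab} T^{ab}`. -/
def inner2 (S T : Fin 3 → Fin 3 → ℝ) : ℝ := ∑ a, ∑ b, S a b * T a b

/-- `∇_a ∇_b c - ½ σ_{ab} Δ c`. -/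
def closedPart (c : S2 → ℝ) (x : S2) (a b : Fin 3) : ℝ :=
  hess c x a b - 1 / 2 * sigma x a b * laplacian c x

/-- `½ (ε_a^e ∇_e ∇_b c + ε_b^e ∇_e ∇_a c)`. -/
def coclosedPart (c : S2 → ℝ) (x : S2) (a b : Fin 3) : ℝ :=
  1 / 2 * ∑ e, (epsilon x a e * hess c x e b + epsilon x b e * hess c x e a)

/-- `f` is smooth on `S²`. -/
def SmoothOnSphere (f : S2 → ℝ) : Prop := ContDiffOn ℝ ∞ (radialExt f) {0}ᶜ

/-- A field depending on a parameter `u ∈ I` and a point of `S²` is jointly smooth. -/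
def JointlySmooth {V : Type} [NormedAddCommGroup V] [NormedSpace ℝ V]
    (I : Set ℝ) (f : ℝ → S2 → V) : Prop :=
  ContDiffOn ℝ ∞ (fun p : ℝ × E3 => radialExt (f p.1) p.2) (I ×ˢ ({0}ᶜ : Set E3))

/-- `f` is a spherical harmonic of mode `ℓ`: it is smooth and `Δ f = -ℓ (ℓ + 1) f`. -/
def IsHarmonicOfMode (l : ℕ) (f : S2 → ℝ) : Prop :=
  SmoothOnSphere f ∧ ∀ x, laplacian f x = -((l : ℝ) * ((l : ℝ) + 1)) * f x

/-- The function `∑ A_{ij} X^i X^j` on `S²`. -/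
def quadForm (A : Matrix (Fin 3) (Fin 3) ℝ) (x : S2) : ℝ := ∑ i, ∑ j, A i j * X i x * X j x

/-- The `ℓ = 2` mode of `f` is `∑ A_{ij} X^i X^j`, with `A` symmetric and traceless: the difference
of the two functions is `L²`-orthogonal to all spherical harmonics of mode `2`. -/
def IsModeTwoPart (f : S2 → ℝ) (A : Matrix (Fin 3) (Fin 3) ℝ) : Prop :=
  A.IsSymm ∧ A.trace = 0 ∧
    ∀ g : S2 → ℝ, IsHarmonicOfMode 2 g → ∫ x, (f x - quadForm A x) * g x ∂area = 0

/-- Null infinity data in Bondi-Sachs coordinates on `I × S²`: a smooth mass aspect `m`, a smooth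
angular momentum aspect one-form `N_A`, and a smooth symmetric traceless shear tensor `C_{AB}`,
with news `N_{AB} = ∂_u C_{AB}`, solving the vacuum Einstein equations at null infinity
(the evolution equations for `m` and `N_A`). -/
structure NullInfinityData (I : Set ℝ) where
  /-- mass aspect -/
  m : ℝ → S2 → ℝ
  /-- angular momentum aspect -/
  aspect : ℝ → S2 → Fin 3 → ℝ
  /-- shear tensor -/
  shear : ℝ → S2 → Fin 3 → Fin 3 → ℝ
  /-- news tensor -/
  news : ℝ → S2 → Fin 3 → Fin 3 → ℝ
  smooth_m : JointlySmooth I m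
  smooth_aspect : JointlySmooth I aspect
  smooth_shear : JointlySmooth I shear
  aspect_tangent : ∀ u ∈ I, ∀ x, ∑ a, aspect u x a * X a x = 0
  shear_tangent : ∀ u ∈ I, ∀ x a, ∑ b, shear u x a b * X b x = 0
  shear_symm : ∀ u ∈ I, ∀ x a b, shear u x a b = shear u x b a
  shear_traceless : ∀ u ∈ I, ∀ x, ∑ a, shear u x a a = 0
  news_eq : ∀ u ∈ I, ∀ x a b, HasDerivWithinAt (fun t => shear t x a b) (news u x a b) I u
  /-- `∂_u m = -⅛ N_{AB} N^{AB} + ¼ ∇^A ∇^B N_{AB}` -/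
  evol_m : ∀ u ∈ I, ∀ x, HasDerivWithinAt (fun t => m t x)
    (-(1 / 8) * inner2 (news u x) (news u x) + 1 / 4 * div1 (div2 (news u)) x) I u
  /-- `∂_u N_A = ∇_A m - ¼ ∇^D (∇_D ∇^E C_{EA} - ∇_A ∇^E C_{ED}) + ¼ ∇_A (C_{BE} N^{BE})
  - ¼ ∇_B (C^{BD} N_{DA}) + ½ C_{AB} ∇_D N^{DB}` -/
  evol_aspect : ∀ u ∈ I, ∀ x a, HasDerivWithinAt (fun t => aspect t x a)
    (grad (m u) x a
      - 1 / 4 * div2 (fun y d e => covDeriv1 (div2 (shear u)) y d e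
          - covDeriv1 (div2 (shear u)) y e d) x a
      + 1 / 4 * grad (fun y => inner2 (shear u y) (news u y)) x a
      - 1 / 4 * div2 (fun y b e => ∑ d, shear u y b d * news u y d e) x a
      + 1 / 2 * ∑ b, shear u x a b * div2 (news u) x b) I u

namespace NullInfinityData

variable {I : Set ℝ} (D : NullInfinityData I)

/-- Energy `E = ∫ 2 m`. -/
def energy (u : ℝ) : ℝ := ∫ x, 2 * D.m u x ∂area

/-- Linear momentum `P^k = ∫ 2 m X^k`. -/
def momentum (k : Fin 3) (u : ℝ) : ℝ := ∫ x, 2 * D.m u x * X k x ∂area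

/-- The rotation Killing field `ε^{AB} ∇_B X^k`. -/
def rotation (k : Fin 3) (x : S2) (a : Fin 3) : ℝ := ∑ b, epsilon x a b * grad (X k) x b

/-- `C_A^D ∇^B C_{DB}`. -/
def shearDiv (u : ℝ) (x : S2) (a : Fin 3) : ℝ := ∑ d, D.shear u x a d * div2 (D.shear u) x d

/-- The modified mass aspect `m - ¼ ∇^A ∇^B C_{AB}`. -/
def modifiedMass (u : ℝ) (x : S2) : ℝ := D.m u x - 1 / 4 * div1 (div2 (D.shear u)) x

/-- The classical angular momentum
`∫ ε^{AB} ∇_B X^k [N_A - ¼ C_A^D ∇^B C_{DB}]`. -/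
def classicalAngularMomentum (k : Fin 3) (u : ℝ) : ℝ :=
  ∫ x, ∑ a, rotation k x a * (D.aspect u x a - 1 / 4 * D.shearDiv u x a) ∂area

/-- The integrand (a one-form) of the classical center of mass:
`N_A - u ∇_A m - ¼ C_A^D ∇^B C_{DB} - (1/16) ∇_A (C_{DE} C^{DE})`. -/
def centerForm (u : ℝ) (x : S2) (a : Fin 3) : ℝ :=
  D.aspect u x a - u * grad (D.m u) x a - 1 / 4 * D.shearDiv u x a
    - 1 / 16 * grad (fun y => inner2 (D.shear u y) (D.shear u y)) x a

/-- The classical center of mass. -/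
def classicalCenterOfMass (k : Fin 3) (u : ℝ) : ℝ :=
  ∫ x, ∑ a, grad (X k) x a * D.centerForm u x a ∂area

/-- The Chen-Wang-Yau angular momentum
`∫ ε^{AB} ∇_B X^k [N_A - ¼ C_A^D ∇^B C_{DB} - c ∇_A m]`, where `c` is the closed potential of the
shear (supported in the modes `ℓ ≥ 2`). -/
def cwyAngularMomentum (c : ℝ → S2 → ℝ) (k : Fin 3) (u : ℝ) : ℝ :=
  ∫ x, ∑ a, rotation k x a *
    (D.aspect u x a - 1 / 4 * D.shearDiv u x a - c u x * grad (D.m u) x a) ∂area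

/-- The Chen-Wang-Yau center of mass in the form used for quadrupole moments:
`∫ ∇^A X^k [N_A - u ∇_A m - ¼ C_A^D ∇^B C_{DB} - (1/16) ∇_A |C|² - 2 c̲ ε_{AB} ∇^B m]`, where `c̲` is
the co-closed potential of the shear. -/
def cwyCenterOfMass (cb : ℝ → S2 → ℝ) (k : Fin 3) (u : ℝ) : ℝ :=
  ∫ x, ∑ a, grad (X k) x a *
    (D.centerForm u x a - 2 * cb u x * ∑ b, epsilon x a b * grad (D.m u) x b) ∂area

/-- The Chen-Wang-Yau center of mass for arbitrary potentials `c`, `c̲` of the shear (supported in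
the modes `ℓ ≥ 2`):
`∫ ∇^A X^k [N_A - u ∇_A m - ¼ C_A^D ∇^B C_{DB} - (1/16) ∇_A |C|² - c ∇_A m + 2 ε_{AB} (∇^B c̲) m]`
`+ ∫ (3 X^k c m - ¼ X^k ∇_A F̲^{AB} ∇^D F̲_{DB})`, where `F̲` is the co-closed part of the shear. -/
def cwyCenterOfMassGeneral (c cb : ℝ → S2 → ℝ) (k : Fin 3) (u : ℝ) : ℝ :=
  (∫ x, ∑ a, grad (X k) x a *
    (D.centerForm u x a - c u x * grad (D.m u) x a
      + 2 * (∑ b, epsilon x a b * grad (cb u) x b) * D.m u x) ∂area)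
  + ∫ x, (3 * X k x * c u x * D.m u x
      - 1 / 4 * X k x * ∑ b, div2 (coclosedPart (cb u)) x b * div2 (coclosedPart (cb u)) x b) ∂area

end NullInfinityData

/-- `∑_{i,j,p} A_{ij} B_{jp} ε^{ipk}`. -/
def epsContract (A B : Matrix (Fin 3) (Fin 3) ℝ) (k : Fin 3) : ℝ :=
  ∑ i, ∑ j, ∑ p, A i j * B j p * leviCivita i p k

/-- `∑_{i,j} A_{ij}²`. -/
def sqNorm (A : Matrix (Fin 3) (Fin 3) ℝ) : ℝ := ∑ i, ∑ j, A i j ^ 2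

/-- The matrix with entries
`(6/7) [∑_i (n_{ik} n_{il} + n̲_{ik} n̲_{il}) - (1/3) δ_{kl} ∑_{ij} (n_{ij}² + n̲_{ij}²)]`. -/
def massModeRate (n nb : Matrix (Fin 3) (Fin 3) ℝ) : Matrix (Fin 3) (Fin 3) ℝ := fun k l =>
  6 / 7 * (∑ i, (n i k * n i l + nb i k * nb i l) - 1 / 3 * delta k l * (sqNorm n + sqNorm nb))

end NullInfinity

end

/-!
Each charge is the integral over the sphere of a component of the data against `X^k`, `∇X^k` or the
Killing field `ε∇X^k`, so its rate is found by inserting the evolution equations and integrating by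
parts; this uses only that `∇∇X^k = -X^k σ`, that Killing fields are divergence free, and that the
duality rotation `T ↦ ε T` of symmetric traceless tensors commutes with the divergence. The terms
linear in the shear drop out, and what is left is bilinear in shear and news.

When the potentials are `ℓ = 2` harmonics, `∇^A C_{AB} = -2 (∇_B c + ε_B^E ∇_E c̲)`. Integrals of an
even function against `X^k` vanish, and after this all bilinear expressions reduce to the single
antisymmetric pairing `∫ f ε^{AB} ∇_B X^k ∇_A g`, which for quadratic forms is a multiple of
`∑ A_{ij} B_{jp} ε^{ipk}`. The Chen-Wang-Yau corrections are such pairings with `m`. Since rotating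
an `ℓ = 2` harmonic gives another one, they see only the `ℓ = 2` mode of `m`, whose rate is the
cubic integral `∫ f |N|² = -12 ∫ f (n² + n̲²)` for an `ℓ = 2` harmonic `f`.
-/

noncomputable section

namespace NullInfinity

/-! ### Calculus of functions on the sphere -/

section RadialExtension

variable {V : Type} (x : S2) {f : S2 → ℝ}

theorem coe_mem_compl_zero : (x : E3) ∈ ({0}ᶜ : Set E3) := ne_zero_of_mem_unit_sphere x

theorem compl_zero_mem_nhds : ({0}ᶜ : Set E3) ∈ nhds (x : E3) :=
  isOpen_compl_singleton.mem_nhds (coe_mem_compl_zero x)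

theorem exists_eq_norm_smul_coe {y : E3} (hy : y ≠ 0) : ∃ x : S2, y = ‖y‖ • (x : E3) :=
  ⟨⟨‖y‖⁻¹ • y, norm_normalize hy⟩, by simp [smul_smul, hy]⟩

@[simp]
theorem radialExt_coe [Zero V] (f : S2 → V) : radialExt f (x : E3) = f x := by
  simp [radialExt, ne_zero_of_mem_unit_sphere x]

theorem radialExt_smul [Zero V] (f : S2 → V) (y : E3) {r : ℝ} (hr : 0 < r) :
    radialExt f (r • y) = radialExt f y := by
  rcases eq_or_ne y 0 with rfl | hy
  · rw [smul_zero]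
  · rw [radialExt, radialExt, dif_neg (smul_ne_zero hr.ne' hy), dif_neg hy]
    congr 2
    rw [norm_smul, Real.norm_of_nonneg hr.le, smul_smul]
    field_simp

theorem radialExt_add [AddZeroClass V] (f g : S2 → V) :
    radialExt (fun x => f x + g x) = fun y => radialExt f y + radialExt g y := by
  ext y; by_cases h : y = 0 <;> simp [radialExt, h]

theorem radialExt_mul [MulZeroClass V] (f g : S2 → V) :
    radialExt (fun x => f x * g x) = fun y => radialExt f y * radialExt g y := by
  ext y; by_cases h : y = 0 <;> simp [radialExt, h]

theorem radialExt_X (k : Fin 3) : radialExt (X k) = fun y : E3 => ‖y‖⁻¹ * y k := by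
  ext y; by_cases h : y = 0 <;> simp [radialExt, h, X]

theorem sum_X_mul_X : ∑ a, X a x * X a x = 1 := by
  have h := EuclideanSpace.norm_sq_eq (x : E3)
  rw [norm_eq_of_mem_sphere] at h
  simpa [X, sq] using h.symm

namespace SmoothOnSphere

theorem differentiableAt (hf : SmoothOnSphere f) : DifferentiableAt ℝ (radialExt f) (x : E3) :=
  (hf.contDiffAt (compl_zero_mem_nhds x)).differentiableAt (by simp)

theorem continuous (hf : SmoothOnSphere f) : Continuous f := by
  simpa [Function.comp_def] using
    hf.continuousOn.comp_continuous continuous_subtype_val coe_mem_compl_zero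

theorem continuousOn_fderiv_apply (hf : SmoothOnSphere f) (v : E3) :
    ContinuousOn (fun y => fderiv ℝ (radialExt f) y v) {0}ᶜ :=
  (hf.continuousOn_fderiv_of_isOpen isOpen_compl_singleton (by simp)).clm_apply continuousOn_const

end SmoothOnSphere

theorem fderiv_radialExt_smul (f : S2 → ℝ) (a : Fin 3) {r : ℝ} (hr : 0 < r) :
    fderiv ℝ (radialExt f) (r • (x : E3)) (EuclideanSpace.single a 1)
      = r⁻¹ * partialDeriv a f x := by
  have h := fderiv_comp_smul (𝕜 := ℝ) r (f := radialExt f) (x := (x : E3))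
  rw [funext fun y => radialExt_smul f y hr] at h
  simp [partialDeriv, h, hr.ne']

theorem radialExt_partialDeriv (f : S2 → ℝ) (a : Fin 3) {y : E3} (hy : y ≠ 0) :
    radialExt (partialDeriv a f) y
      = ‖y‖ * fderiv ℝ (radialExt f) y (EuclideanSpace.single a 1) := by
  obtain ⟨x, hx⟩ := exists_eq_norm_smul_coe hy
  have hpos : 0 < ‖y‖ := norm_pos_iff.2 hy
  rw [hx, radialExt_smul _ _ hpos, radialExt_coe, fderiv_radialExt_smul x f a hpos, ← hx,
    mul_inv_cancel_left₀ hpos.ne']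

theorem hasFDerivAt_norm_coe : HasFDerivAt (fun y : E3 => ‖y‖) (innerSL ℝ (x : E3)) (x : E3) := by
  have hx : ‖(x : E3)‖ = 1 := norm_eq_of_mem_sphere x
  have := ((hasStrictFDerivAt_norm_sq (x : E3)).hasFDerivAt).sqrt (by simp [hx])
  simpa [hx, Real.sqrt_sq, smul_smul, ← ofNat_smul_eq_nsmul ℝ] using this

theorem SmoothOnSphere.partialDeriv (hf : SmoothOnSphere f) (a : Fin 3) :
    SmoothOnSphere (partialDeriv a f) :=
  ContDiffOn.congr ((contDiffOn_id.norm ℝ fun _ hy => hy).mul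
    ((hf.fderiv_of_isOpen isOpen_compl_singleton (by simp)).clm_apply contDiffOn_const))
    fun _ hy => radialExt_partialDeriv f a hy

theorem sum_X_mul_partialDeriv (hf : SmoothOnSphere f) :
    ∑ a, X a x * partialDeriv a f x = 0 := by
  have hbasis : (x : E3) = ∑ a, X a x • EuclideanSpace.single a (1 : ℝ) := by
    ext i; fin_cases i <;> simp [Fin.sum_univ_three, X]
  have hline : HasDerivAt (fun t : ℝ => t • (x : E3)) (x : E3) 1 := by
    simpa using (hasDerivAt_id (1 : ℝ)).smul_const (x : E3)
  have hradial := HasFDerivAt.comp_hasDerivAt (1 : ℝ)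
    (by simpa using (hf.differentiableAt x).hasFDerivAt) hline
  have hconst : (radialExt f ∘ fun t : ℝ => t • (x : E3)) =ᶠ[nhds 1] fun _ => f x := by
    filter_upwards [lt_mem_nhds (zero_lt_one' ℝ)] with t ht
    simp [radialExt_smul f _ ht]
  calc ∑ a, X a x * partialDeriv a f x = fderiv ℝ (radialExt f) (x : E3) (x : E3) := by
        conv_rhs => rw [hbasis, map_sum]
        simp only [map_smul, smul_eq_mul, ← hbasis, partialDeriv]
    _ = 0 := hradial.unique ((hasDerivAt_const (1 : ℝ) (f x)).congr_of_eventuallyEq hconst)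

end RadialExtension

/-- `f` is smooth on the sphere and its surface gradient is the field `g`: the analogue of
`HasFDerivAt` by which gradients are computed here. -/
structure HasGrad (f : S2 → ℝ) (g : S2 → Fin 3 → ℝ) : Prop where
  smooth : SmoothOnSphere f
  eq : ∀ a x, partialDeriv a f x = g x a

namespace HasGrad

variable {f f' : S2 → ℝ} {g g' : S2 → Fin 3 → ℝ}

theorem of_smooth (hf : SmoothOnSphere f) : HasGrad f (grad f) :=
  ⟨hf, fun _ _ => rfl⟩

theorem grad_eq (h : HasGrad f g) : grad f = g := by
  ext x a; exact h.eq a x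

theorem congr (h : HasGrad f g) (hg : ∀ x a, g x a = g' x a) : HasGrad f g' :=
  ⟨h.smooth, fun a x => (h.eq a x).trans (hg x a)⟩

theorem add (h : HasGrad f g) (h' : HasGrad f' g') :
    HasGrad (fun x => f x + f' x) (fun x a => g x a + g' x a) := by
  constructor
  · rw [SmoothOnSphere, radialExt_add]; exact h.smooth.add h'.smooth
  · intro a x
    rw [← h.eq, ← h'.eq, partialDeriv, radialExt_add,
      fderiv_fun_add (h.smooth.differentiableAt x) (h'.smooth.differentiableAt x)]
    rfl

theorem mul (h : HasGrad f g) (h' : HasGrad f' g') :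
    HasGrad (fun x => f x * f' x) (fun x a => f x * g' x a + f' x * g x a) := by
  constructor
  · rw [SmoothOnSphere, radialExt_mul]; exact h.smooth.mul h'.smooth
  · intro a x
    rw [← h.eq, ← h'.eq, partialDeriv, radialExt_mul,
      fderiv_fun_mul (h.smooth.differentiableAt x) (h'.smooth.differentiableAt x)]
    simp [partialDeriv]

theorem const (r : ℝ) : HasGrad (fun _ => r) (fun _ _ => 0) := by
  have h : ∀ y ∈ ({0}ᶜ : Set E3), radialExt (fun _ : S2 => r) y = r := fun y hy => dif_neg hy
  refine ⟨contDiffOn_const.congr h, fun a x => ?_⟩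
  have h' : radialExt (fun _ : S2 => r) =ᶠ[nhds (x : E3)] fun _ => r :=
    Filter.eventually_of_mem (compl_zero_mem_nhds x) h
  simp [partialDeriv, h'.fderiv_eq]

theorem coord (k : Fin 3) : HasGrad (X k) (fun x a => sigma x a k) := by
  constructor
  · rw [SmoothOnSphere, radialExt_X]
    have hnorm : ContDiffOn ℝ ∞ (fun y : E3 => ‖y‖) {0}ᶜ := contDiffOn_id.norm ℝ fun y hy => hy
    exact (hnorm.inv fun y hy => norm_ne_zero_iff.2 hy).mul (by fun_prop)
  · intro a x
    have hx : ‖(x : E3)‖ = 1 := norm_eq_of_mem_sphere x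
    have hX := ((hasDerivAt_inv (by simp [hx])).comp_hasFDerivAt _ (hasFDerivAt_norm_coe x)).fun_mul
      (EuclideanSpace.proj k : E3 →L[ℝ] ℝ).hasFDerivAt
    simp only [EuclideanSpace.coe_proj, Function.comp_def] at hX
    rw [partialDeriv, radialExt_X, hX.fderiv]
    rcases eq_or_ne a k with rfl | h
    · simp [hx, sigma, delta, X, EuclideanSpace.inner_single_right]
      ring
    · simp [hx, sigma, delta, X, EuclideanSpace.inner_single_right, h, h.symm]
      ring

theorem const_mul (r : ℝ) (h : HasGrad f g) :
    HasGrad (fun x => r * f x) (fun x a => r * g x a) :=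
  ((const r).mul h).congr fun x a => by ring

theorem sub (h : HasGrad f g) (h' : HasGrad f' g') :
    HasGrad (fun x => f x - f' x) (fun x a => g x a - g' x a) := by
  simpa only [sub_eq_add_neg, neg_one_mul] using h.add (h'.const_mul (-1))

theorem sum {ι : Type*} (s : Finset ι) {f : ι → S2 → ℝ} {g : ι → S2 → Fin 3 → ℝ}
    (h : ∀ i ∈ s, HasGrad (f i) (g i)) :
    HasGrad (fun x => ∑ i ∈ s, f i x) (fun x a => ∑ i ∈ s, g i x a) := by
  classical
  induction s using Finset.induction_on with
  | empty => simpa using const 0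
  | insert i s hi ih =>
    simp only [Finset.sum_insert hi]
    exact (h i (by simp)).add (ih fun j hj => h j (by simp [hj]))

end HasGrad

namespace SmoothOnSphere

variable {f g : S2 → ℝ}

theorem const (r : ℝ) : SmoothOnSphere fun _ => r :=
  (HasGrad.const r).smooth

theorem add (hf : SmoothOnSphere f) (hg : SmoothOnSphere g) : SmoothOnSphere fun x => f x + g x :=
  ((HasGrad.of_smooth hf).add (.of_smooth hg)).smooth

theorem sub (hf : SmoothOnSphere f) (hg : SmoothOnSphere g) : SmoothOnSphere fun x => f x - g x :=
  ((HasGrad.of_smooth hf).sub (.of_smooth hg)).smooth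

theorem mul (hf : SmoothOnSphere f) (hg : SmoothOnSphere g) : SmoothOnSphere fun x => f x * g x :=
  ((HasGrad.of_smooth hf).mul (.of_smooth hg)).smooth

theorem sum {ι : Type*} (s : Finset ι) {f : ι → S2 → ℝ} (hf : ∀ i ∈ s, SmoothOnSphere (f i)) :
    SmoothOnSphere fun x => ∑ i ∈ s, f i x :=
  (HasGrad.sum s fun i hi => .of_smooth (hf i hi)).smooth

end SmoothOnSphere

theorem smooth_X (k : Fin 3) : SmoothOnSphere (X k) :=
  (HasGrad.coord k).smooth

theorem SmoothOnSphere.grad {f : S2 → ℝ} (hf : SmoothOnSphere f) (a : Fin 3) :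
    SmoothOnSphere fun x => grad f x a :=
  hf.partialDeriv a

attribute [fun_prop] SmoothOnSphere SmoothOnSphere.const SmoothOnSphere.add SmoothOnSphere.sub
  SmoothOnSphere.mul SmoothOnSphere.sum smooth_X SmoothOnSphere.grad

/-! ### Integration over the sphere -/

section PolarCoordinates

open Metric Module

variable {E : Type*} [NormedAddCommGroup E] [NormedSpace ℝ E] [MeasurableSpace E] [BorelSpace E]

theorem measurePreserving_neg_toSphere (μ : Measure E) [μ.IsNegInvariant] :
    MeasurePreserving (fun x : sphere (0 : E) 1 => -x) μ.toSphere μ.toSphere := by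
  refine ⟨continuous_neg.measurable, Measure.ext fun s hs => ?_⟩
  have hcoe : ((↑) '' (Neg.neg ⁻¹' s) : Set E) = -((↑) '' s) := by
    ext y
    constructor
    · rintro ⟨x, hx, rfl⟩
      exact ⟨-x, hx, rfl⟩
    · rintro ⟨x, hx, h⟩
      exact ⟨-x, by simpa using hx, by simp [h]⟩
  rw [Measure.map_apply continuous_neg.measurable hs, Measure.toSphere_apply' _ hs,
    Measure.toSphere_apply' _ (continuous_neg.measurable hs), hcoe, Set.smul_neg,
    Measure.measure_neg]

theorem integral_toSphere_eq_zero_of_odd {μ : Measure E} [μ.IsNegInvariant]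
    {f : sphere (0 : E) 1 → ℝ} (hf : ∀ x, f (-x) = -f x) : ∫ x, f x ∂μ.toSphere = 0 := by
  have h := (measurePreserving_neg_toSphere μ).integral_comp
    (Homeomorph.neg (sphere (0 : E) 1)).measurableEmbedding f
  simp only [hf, integral_neg] at h
  linarith

theorem integral_eq_mul_integral_toSphere [FiniteDimensional ℝ E] [Nontrivial E] (μ : Measure E)
    [μ.IsAddHaarMeasure] {h : E → ℝ} {p : ℝ → ℝ} {q : sphere (0 : E) 1 → ℝ}
    (H : ∀ (x : sphere (0 : E) 1) (r : ℝ), 0 < r → h (r • (x : E)) = p r * q x) :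
    ∫ y, h y ∂μ =
      (∫ r : Ioi (0 : ℝ), p r ∂Measure.volumeIoiPow (finrank ℝ E - 1)) * ∫ x, q x ∂μ.toSphere := by
  have hsplit : ∀ y : ({0}ᶜ : Set E), h y =
      q (homeomorphUnitSphereProd E y).1 * p ((homeomorphUnitSphereProd E y).2 : ℝ) := by
    intro y
    rw [mul_comm, ← H _ _ (homeomorphUnitSphereProd E y).2.2]
    congr 1
    simp [smul_smul, norm_ne_zero_iff.2 y.2]
  calc ∫ y, h y ∂μ = ∫ y : ({0}ᶜ : Set E), h y ∂(μ.comap (↑)) := by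
        rw [integral_subtype_comap (measurableSet_singleton _).compl, restrict_compl_singleton]
    _ = ∫ z, q z.1 * p (z.2 : ℝ)
          ∂(μ.toSphere.prod (Measure.volumeIoiPow (finrank ℝ E - 1))) := by
        simp only [hsplit]
        exact μ.measurePreserving_homeomorphUnitSphereProd.integral_comp
          (homeomorphUnitSphereProd E).measurableEmbedding fun z => q z.1 * p (z.2 : ℝ)
    _ = _ := by
        rw [integral_prod_mul q fun r : Ioi (0 : ℝ) => p r, mul_comm]

end PolarCoordinates

theorem integrable_mul_of_tsupport_subset {Y : Type*} [TopologicalSpace Y] [MeasurableSpace Y]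
    [OpensMeasurableSpace Y] {μ : Measure Y} [IsFiniteMeasureOnCompacts μ] {U : Set Y} {g h : Y → ℝ}
    (hU : IsOpen U) (hg : Continuous g) (hcs : HasCompactSupport g) (hs : tsupport g ⊆ U)
    (hh : ContinuousOn h U) : Integrable (fun y => g y * h y) μ :=
  ((hg.continuousOn.mul hh).continuous_of_tsupport_subset hU
    ((tsupport_mul_subset_left (f := g) (g := h)).trans hs)).integrable_of_hasCompactSupport
      hcs.mul_right

instance : IsFiniteMeasure area := inferInstanceAs (IsFiniteMeasure (volume : Measure E3).toSphere)

theorem integrable_of_continuous {f : S2 → ℝ} (hf : Continuous f) : Integrable f area :=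
  hf.integrable_of_hasCompactSupport (HasCompactSupport.of_compactSpace f)

theorem SmoothOnSphere.integrable {f : S2 → ℝ} (hf : SmoothOnSphere f) : Integrable f area :=
  integrable_of_continuous hf.continuous

theorem integral_const_area (r : ℝ) : ∫ _, r ∂area = 4 * Real.pi * r := by
  have h : area.real univ = 4 * Real.pi := by
    rw [area, Measure.toSphere_real_apply_univ, measureReal_def,
      EuclideanSpace.volume_ball_fin_three, ENNReal.toReal_mul, ENNReal.toReal_pow,
      ENNReal.toReal_ofReal zero_le_one, ENNReal.toReal_ofReal (by positivity),
      finrank_euclideanSpace_fin]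
    push_cast
    ring
  rw [integral_const, h, smul_eq_mul]

/-! ### The divergence theorem -/

/-- The profile of `shellBump` as a function of the squared distance to the origin. -/
def shellProfile : ContDiffBump (2 : ℝ) := ⟨1 / 2, 1, by norm_num, by norm_num⟩

/-- A smooth radial function on `ℝ³` supported in the shell `1 ≤ ‖y‖² ≤ 3`. It carries integrals
over the sphere to integrals over `ℝ³`, where integration by parts is available. -/
def shellBump (y : E3) : ℝ := shellProfile (‖y‖ ^ 2)

theorem shellBump_smul_coe (x : S2) (r : ℝ) : shellBump (r • (x : E3)) = shellProfile (r ^ 2) := by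
  simp [shellBump, norm_smul]

theorem contDiff_shellBump : ContDiff ℝ ∞ shellBump :=
  shellProfile.contDiff.comp (contDiff_norm_sq ℝ)

theorem tsupport_shellBump_subset : tsupport shellBump ⊆ {y : E3 | 1 ≤ ‖y‖ ^ 2 ∧ ‖y‖ ^ 2 ≤ 3} := by
  refine closure_minimal (fun y hy => ?_) <|
    (isClosed_le continuous_const (continuous_norm.pow 2)).inter
      (isClosed_le (continuous_norm.pow 2) continuous_const)
  have hmem : ‖y‖ ^ 2 ∈ Metric.ball (2 : ℝ) 1 := shellProfile.support_eq ▸ hy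
  rw [Real.ball_eq_Ioo, mem_Ioo] at hmem
  constructor <;> linarith

theorem tsupport_shellBump_subset_compl : tsupport shellBump ⊆ {0}ᶜ := by
  rintro y hy rfl
  have := (tsupport_shellBump_subset hy).1
  norm_num at this

theorem hasCompactSupport_shellBump : HasCompactSupport shellBump := by
  refine (isCompact_closedBall (0 : E3) 2).of_isClosed_subset (isClosed_tsupport _) fun y hy => ?_
  have := (tsupport_shellBump_subset hy).2
  rw [mem_closedBall_zero_iff]
  nlinarith [norm_nonneg y]

theorem fderiv_shellBump (x : S2) (a : Fin 3) (r : ℝ) :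
    fderiv ℝ shellBump (r • (x : E3)) (EuclideanSpace.single a 1)
      = 2 * r * deriv shellProfile (r ^ 2) * X a x := by
  have hprofile : HasDerivAt shellProfile (deriv shellProfile (r ^ 2)) (‖r • (x : E3)‖ ^ 2) := by
    rw [show ‖r • (x : E3)‖ ^ 2 = r ^ 2 by simp [norm_smul]]
    exact (shellProfile.contDiff.differentiable (n := 1) (by simp) _).hasDerivAt
  have h := hprofile.comp_hasFDerivAt (r • (x : E3)) (hasStrictFDerivAt_norm_sq _).hasFDerivAt
  rw [show shellBump = shellProfile ∘ fun y : E3 => ‖y‖ ^ 2 from rfl, h.fderiv]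
  simp [EuclideanSpace.inner_single_right, X]
  ring

theorem integral_shellBump_mul_fderiv {f : S2 → ℝ} (hf : SmoothOnSphere f) (v : E3) :
    ∫ y, shellBump y * fderiv ℝ (radialExt f) y v = -∫ y, fderiv ℝ shellBump y v * radialExt f y :=
  have hdiff : Differentiable ℝ shellBump := contDiff_shellBump.differentiable (by simp)
  have hcont : Continuous fun y => fderiv ℝ shellBump y v :=
    (contDiff_shellBump.continuous_fderiv (by simp)).clm_apply continuous_const
  integral_mul_fderiv_eq_neg_fderiv_mul_of_integrable
    (integrable_mul_of_tsupport_subset isOpen_compl_singleton hcont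
      (hasCompactSupport_shellBump.fderiv_apply (𝕜 := ℝ) v)
      ((tsupport_fderiv_apply_subset ℝ v).trans tsupport_shellBump_subset_compl) hf.continuousOn)
    (integrable_mul_of_tsupport_subset isOpen_compl_singleton hdiff.continuous
      hasCompactSupport_shellBump tsupport_shellBump_subset_compl (hf.continuousOn_fderiv_apply v))
    (integrable_mul_of_tsupport_subset isOpen_compl_singleton hdiff.continuous
      hasCompactSupport_shellBump tsupport_shellBump_subset_compl hf.continuousOn)
    (fun y _ => hdiff y)
    (fun _ hy => (hf.contDiffAt (isOpen_compl_singleton.mem_nhds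
      (tsupport_shellBump_subset_compl hy))).differentiableAt (by simp))

theorem integral_shellBump_mul_inv_norm_pos : 0 < ∫ y : E3, shellBump y * ‖y‖⁻¹ := by
  have hcont : Continuous fun y : E3 => shellBump y * ‖y‖⁻¹ :=
    ContinuousOn.continuous_of_tsupport_subset
      (contDiff_shellBump.continuous.continuousOn.mul
        (continuous_norm.continuousOn.inv₀ fun y hy => norm_ne_zero_iff.2 hy))
      isOpen_compl_singleton
      ((tsupport_mul_subset_left (g := fun y : E3 => ‖y‖⁻¹)).trans tsupport_shellBump_subset_compl)
  refine hcont.integral_pos_of_hasCompactSupport_nonneg_nonzero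
    hasCompactSupport_shellBump.mul_right
    (fun y => mul_nonneg shellProfile.nonneg (inv_nonneg.2 (norm_nonneg y)))
    (x := EuclideanSpace.single 0 √2) ?_
  have hone : shellBump (EuclideanSpace.single 0 √2) = 1 :=
    shellProfile.one_of_mem_closedBall (by simp [shellProfile])
  simp [hone]

theorem exists_integral_partialDeriv_eq_mul : ∃ κ : ℝ, ∀ (a : Fin 3) {f : S2 → ℝ},
    SmoothOnSphere f → ∫ x, partialDeriv a f x ∂area = κ * ∫ x, X a x * f x ∂area := by
  set α := ∫ r : Ioi (0 : ℝ), shellProfile ((r : ℝ) ^ 2) * (r : ℝ)⁻¹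
    ∂Measure.volumeIoiPow (Module.finrank ℝ E3 - 1)
  set β := ∫ r : Ioi (0 : ℝ), 2 * (r : ℝ) * deriv shellProfile ((r : ℝ) ^ 2)
    ∂Measure.volumeIoiPow (Module.finrank ℝ E3 - 1)
  have hα : α ≠ 0 := by
    have hpos := integral_shellBump_mul_inv_norm_pos
    rw [integral_eq_mul_integral_toSphere volume (p := fun r => shellProfile (r ^ 2) * r⁻¹)
      (q := fun _ => 1) fun x r hr => by
        simp [shellBump_smul_coe, norm_smul, abs_of_pos hr]] at hpos
    exact left_ne_zero_of_mul hpos.ne'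
  refine ⟨-β / α, fun a f hf => ?_⟩
  have h := integral_shellBump_mul_fderiv hf (EuclideanSpace.single a 1)
  rw [integral_eq_mul_integral_toSphere volume (p := fun r => shellProfile (r ^ 2) * r⁻¹)
      (q := partialDeriv a f) fun x r hr => by
        rw [fderiv_radialExt_smul x f a hr, shellBump_smul_coe, mul_assoc],
    integral_eq_mul_integral_toSphere volume (p := fun r => 2 * r * deriv shellProfile (r ^ 2))
      (q := fun x => X a x * f x) fun x r hr => by
        rw [fderiv_shellBump, radialExt_smul f _ hr, radialExt_coe, mul_assoc]] at h
  change α * ∫ x, partialDeriv a f x ∂area = -(β * ∫ x, X a x * f x ∂area) at h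
  field_simp
  linear_combination h

theorem integral_partialDeriv {f : S2 → ℝ} (hf : SmoothOnSphere f) (a : Fin 3) :
    ∫ x, partialDeriv a f x ∂area = 2 * ∫ x, X a x * f x ∂area := by
  obtain ⟨κ, hκ⟩ := exists_integral_partialDeriv_eq_mul
  -- The constant is found by summing over the coordinate functions, for which `∑ ∂ₐXᵃ = 2`.
  have hdiv : ∑ a, ∫ x, partialDeriv a (X a) x ∂area = 4 * Real.pi * 2 := by
    rw [← integral_finsetSum _ fun a _ => ((smooth_X a).partialDeriv a).integrable,
      ← integral_const_area]
    refine integral_congr_ae (.of_forall fun x => ?_)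
    have h := sum_X_mul_X x
    simp only [(HasGrad.coord _).eq, sigma, delta, if_true, Fin.sum_univ_three] at h ⊢
    linear_combination -h
  have hone : ∑ a, ∫ x, X a x * X a x ∂area = 4 * Real.pi := by
    rw [← integral_finsetSum _ fun a _ =>
      ((smooth_X a).mul (smooth_X a)).integrable]
    simp only [sum_X_mul_X, integral_const_area, mul_one]
  simp only [hκ _ (smooth_X _), ← Finset.mul_sum, hone] at hdiv
  rw [hκ a hf, mul_left_cancel₀ (by positivity) ((mul_comm _ _).trans hdiv)]

/-! ### The round metric and the area form -/

section Frame

variable (x : S2) (a b c : Fin 3)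

theorem sigma_symm : sigma x a b = sigma x b a := by
  simp only [sigma, delta, eq_comm (a := a), mul_comm (X a x)]

theorem sum_sigma_mul (v : Fin 3 → ℝ) :
    ∑ b, sigma x a b * v b = v a - X a x * ∑ b, X b x * v b := by
  simp [sigma, delta, sub_mul, Finset.sum_sub_distrib, Finset.mul_sum, mul_assoc]

theorem sum_sigma_mul_of_tangent {v : Fin 3 → ℝ} (hv : ∑ a, v a * X a x = 0) :
    ∑ b, sigma x a b * v b = v a := by
  simp only [mul_comm (v _)] at hv
  rw [sum_sigma_mul, hv, mul_zero, sub_zero]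

theorem sum_sigma_mul_X : ∑ b, sigma x a b * X b x = 0 := by
  rw [sum_sigma_mul, sum_X_mul_X, mul_one, sub_self]

theorem sum_mul_sum_sigma_mul {v : Fin 3 → ℝ} (hv : ∑ a, v a * X a x = 0) (w : Fin 3 → ℝ) :
    ∑ a, v a * ∑ b, sigma x a b * w b = ∑ a, v a * w a := by
  simp only [sum_sigma_mul, mul_sub, Finset.sum_sub_distrib, ← mul_assoc, ← Finset.sum_mul, hv,
    zero_mul, sub_zero]

theorem sum_sigma_self : ∑ a, sigma x a a = 2 := by
  simp only [sigma, delta, if_true, Finset.sum_sub_distrib, sum_X_mul_X]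
  norm_num

theorem epsilon_antisymm : epsilon x a b = -epsilon x b a := by
  simp only [epsilon, leviCivita, ← Finset.sum_neg_distrib]
  exact Finset.sum_congr rfl fun c _ => by ring

theorem sum_epsilon_mul_X : ∑ b, epsilon x a b * X b x = 0 := by
  fin_cases a <;> simp [epsilon, leviCivita, Fin.sum_univ_three] <;> ring

theorem sum_epsilon_mul_epsilon : ∑ c, epsilon x a c * epsilon x c b = -sigma x a b := by
  have hX := sum_X_mul_X x
  fin_cases a <;> fin_cases b <;>
    simp [epsilon, leviCivita, sigma, delta, Fin.sum_univ_three] at hX ⊢ <;> linarith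

theorem leviCivita_eq : leviCivita a b c =
    X a x * epsilon x b c + X b x * epsilon x c a + X c x * epsilon x a b := by
  have hX := sum_X_mul_X x
  fin_cases a <;> fin_cases b <;> fin_cases c <;>
    simp [epsilon, leviCivita, Fin.sum_univ_three] at hX ⊢ <;> linarith

theorem sum_sigma_mul_epsilon : ∑ c, sigma x a c * epsilon x c b = epsilon x a b := by
  refine sum_sigma_mul_of_tangent x a ?_
  rw [← neg_eq_zero, ← Finset.sum_neg_distrib, ← sum_epsilon_mul_X x b]
  exact Finset.sum_congr rfl fun c _ => by rw [epsilon_antisymm x b c]; ring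

theorem sum_epsilon_mul_sigma : ∑ c, epsilon x a c * sigma x c b = epsilon x a b := by
  rw [epsilon_antisymm, ← sum_sigma_mul_epsilon, ← Finset.sum_neg_distrib]
  exact Finset.sum_congr rfl fun c _ => by rw [epsilon_antisymm x a c, sigma_symm]; ring

theorem sum_sum_mul_eq_zero {M : Fin 3 → Fin 3 → ℝ} {w : Fin 3 → ℝ}
    (h : ∀ b, ∑ a, M a b * w a = 0) (v : Fin 3 → ℝ) : ∑ a, (∑ b, M a b * v b) * w a = 0 := by
  simp only [Finset.sum_mul, mul_right_comm _ (v _)]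
  rw [Finset.sum_comm]
  simp only [← Finset.sum_mul, h, zero_mul, Finset.sum_const_zero]

theorem sum_epsilon_mul_X_left : ∑ a, epsilon x a b * X a x = 0 := by
  simp only [epsilon_antisymm x _ b, neg_mul, Finset.sum_neg_distrib, sum_epsilon_mul_X, neg_zero]

theorem sum_sigma_mul_X_left : ∑ a, sigma x a b * X a x = 0 := by
  simp only [sigma_symm x _ b, sum_sigma_mul_X]

end Frame

theorem hasGrad_epsilon (b c : Fin 3) : HasGrad (fun x => epsilon x b c)
    (fun x a => X b x * epsilon x c a + X c x * epsilon x a b) := by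
  refine (HasGrad.sum Finset.univ fun e _ =>
    (HasGrad.coord e).const_mul (leviCivita b c e)).congr fun x a => ?_
  have h : ∑ e, leviCivita b c e * sigma x a e = leviCivita b c a - X a x * epsilon x b c := by
    simp only [mul_comm (leviCivita b c _), sum_sigma_mul, epsilon]
  rw [h, leviCivita_eq x]
  ring

theorem smooth_epsilon (a b : Fin 3) : SmoothOnSphere fun x => epsilon x a b :=
  (hasGrad_epsilon a b).smooth

theorem hasGrad_sigma (a b : Fin 3) : HasGrad (fun x => sigma x a b)
    (fun x c => -(X a x * sigma x c b + X b x * sigma x c a)) :=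
  ((HasGrad.const (delta a b)).sub ((HasGrad.coord a).mul (.coord b))).congr fun _ _ => zero_sub _

theorem smooth_sigma (a b : Fin 3) : SmoothOnSphere fun x => sigma x a b :=
  (hasGrad_sigma a b).smooth

attribute [fun_prop] SmoothOnSphere.partialDeriv smooth_epsilon smooth_sigma

/-! ### One-forms and tensors -/

/-- A smooth one-form on the sphere, in the ambient frame. -/
structure IsOneForm (V : S2 → Fin 3 → ℝ) : Prop where
  smooth : ∀ a, SmoothOnSphere fun x => V x a
  tangent : ∀ x, ∑ a, V x a * X a x = 0

/-- A smooth covariant 2-tensor on the sphere, in the ambient frame. -/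
structure IsTensor (T : S2 → Fin 3 → Fin 3 → ℝ) : Prop where
  smooth : ∀ a b, SmoothOnSphere fun x => T x a b
  tangent_left : ∀ x b, ∑ a, T x a b * X a x = 0
  tangent_right : ∀ x a, ∑ b, T x a b * X b x = 0

/-- The rotation `ε_a^e V_e` of a one-form by a quarter turn. -/
def hodge (V : S2 → Fin 3 → ℝ) (x : S2) (a : Fin 3) : ℝ := ∑ e, epsilon x a e * V x e

/-- The contraction `T_a^b V_b`. -/
def contract (T : S2 → Fin 3 → Fin 3 → ℝ) (V : S2 → Fin 3 → ℝ) (x : S2) (a : Fin 3) : ℝ :=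
  ∑ b, T x a b * V x b

section Closure

variable {f : S2 → ℝ} {V : S2 → Fin 3 → ℝ} {S T : S2 → Fin 3 → Fin 3 → ℝ}

theorem IsOneForm.grad (hf : SmoothOnSphere f) : IsOneForm (grad f) where
  smooth a := hf.grad a
  tangent x :=
    (Finset.sum_congr rfl fun _ _ => mul_comm _ _).trans (sum_X_mul_partialDeriv x hf)

theorem IsOneForm.hodge (hV : IsOneForm V) : IsOneForm (hodge V) where
  smooth a := by have := hV.smooth; unfold NullInfinity.hodge; fun_prop
  tangent x := sum_sum_mul_eq_zero (sum_epsilon_mul_X_left x) (V x)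

theorem IsTensor.contract (hT : IsTensor T) (hV : ∀ a, SmoothOnSphere fun x => V x a) :
    IsOneForm (contract T V) where
  smooth a := by have := hT.smooth; unfold NullInfinity.contract; fun_prop
  tangent x := sum_sum_mul_eq_zero (hT.tangent_left x) (V x)

theorem IsTensor.covDeriv1 (hV : ∀ a, SmoothOnSphere fun x => V x a) :
    IsTensor (covDeriv1 V) where
  smooth a b := by unfold NullInfinity.covDeriv1; fun_prop
  tangent_left x b := by
    simp only [NullInfinity.covDeriv1, mul_comm (sigma x b _)]
    exact sum_sum_mul_eq_zero (fun c => (IsOneForm.grad (hV c)).tangent x) _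
  tangent_right x a := sum_sum_mul_eq_zero (sum_sigma_mul_X_left x) _

theorem sum_sigma_mul_partialDeriv (hf : SmoothOnSphere f) (x : S2) (a : Fin 3) :
    ∑ b, sigma x a b * partialDeriv b f x = partialDeriv a f x :=
  sum_sigma_mul_of_tangent x a ((IsOneForm.grad hf).tangent x)

theorem div1_eq (hV : ∀ a, SmoothOnSphere fun x => V x a) (x : S2) :
    div1 V x = ∑ a, partialDeriv a (fun y => V y a) x := by
  simp only [div1, covDeriv1]
  rw [Finset.sum_comm]
  simp only [sigma_symm x _ (_ : Fin 3), sum_sigma_mul_partialDeriv (hV _)]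

theorem div2_eq (hT : ∀ a b, SmoothOnSphere fun x => T x a b) (x : S2) (b : Fin 3) :
    div2 T x b = ∑ c, sigma x b c * ∑ a, partialDeriv a (fun y => T y a c) x := by
  simp only [div2, covDeriv2]
  rw [Finset.sum_comm_cycle]
  refine Finset.sum_congr rfl fun c _ => ?_
  rw [Finset.sum_comm, Finset.mul_sum]
  refine Finset.sum_congr rfl fun d _ => ?_
  rw [← sum_sigma_mul_partialDeriv (hT d c), Finset.mul_sum]
  exact Finset.sum_congr rfl fun a _ => by rw [sigma_symm]; ring

theorem isOneForm_div2 (hT : ∀ a b, SmoothOnSphere fun x => T x a b) : IsOneForm (div2 T) where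
  smooth a := by unfold div2 covDeriv2; fun_prop
  tangent x := by
    simp only [div2_eq hT]
    exact sum_sum_mul_eq_zero (sum_sigma_mul_X_left x) _

end Closure

/-! ### Integration by parts -/

section IntegrationByParts

variable {f : S2 → ℝ} {V W : S2 → Fin 3 → ℝ} {S T : S2 → Fin 3 → Fin 3 → ℝ}

theorem div1_smul (hf : SmoothOnSphere f) (hV : ∀ a, SmoothOnSphere fun x => V x a) (x : S2) :
    div1 (fun y a => f y * V y a) x = f x * div1 V x + ∑ a, V x a * grad f x a := by
  rw [div1_eq hV, div1_eq fun a => by fun_prop, Finset.mul_sum, ← Finset.sum_add_distrib]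
  exact Finset.sum_congr rfl fun a _ => ((HasGrad.of_smooth hf).mul (.of_smooth (hV a))).eq a x

theorem sum_mul_div2 (hV : IsOneForm V) (hT : ∀ a b, SmoothOnSphere fun x => T x a b) (x : S2) :
    ∑ b, V x b * div2 T x b = ∑ b, V x b * ∑ a, partialDeriv a (fun y => T y a b) x := by
  simp only [div2_eq hT]
  exact sum_mul_sum_sigma_mul x (hV.tangent x) _

theorem div1_contract (hT : IsTensor T) (hV : IsOneForm V) (x : S2) :
    div1 (contract T V) x = ∑ b, V x b * div2 T x b + inner2 (covDeriv1 V x) (T x) := by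
  have hgrad : ∀ a, HasGrad (fun y => contract T V y a)
      (fun y d => ∑ b, (T y a b * grad (fun z => V z b) y d
        + V y b * grad (fun z => T z a b) y d)) :=
    fun a => .sum _ fun b _ => (HasGrad.of_smooth (hT.smooth a b)).mul (.of_smooth (hV.smooth b))
  have hinner : inner2 (covDeriv1 V x) (T x)
      = ∑ a, ∑ b, T x a b * partialDeriv a (fun y => V y b) x := by
    refine Finset.sum_congr rfl fun a _ => ?_
    rw [← sum_mul_sum_sigma_mul x (hT.tangent_right x a)]
    exact Finset.sum_congr rfl fun b _ => mul_comm _ _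
  rw [div1_eq fun a => (hgrad a).smooth, hinner, sum_mul_div2 hV hT.smooth, add_comm]
  simp only [(hgrad _).eq, Finset.sum_add_distrib, Finset.mul_sum]
  rw [Finset.sum_comm (f := fun b a => V x b * _)]
  rfl

theorem integral_div1 (hV : IsOneForm V) : ∫ x, div1 V x ∂area = 0 := by
  simp only [div1_eq hV.smooth]
  rw [integral_finsetSum _ fun a _ => ((hV.smooth a).partialDeriv a).integrable]
  simp only [integral_partialDeriv (hV.smooth _), ← Finset.mul_sum]
  rw [← integral_finsetSum _ fun a _ => ((smooth_X a).mul (hV.smooth a)).integrable]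
  simp only [mul_comm (X _ _), hV.tangent, integral_zero, mul_zero]

theorem IsOneForm.smul (hf : SmoothOnSphere f) (hV : IsOneForm V) :
    IsOneForm fun x a => f x * V x a where
  smooth a := hf.mul (hV.smooth a)
  tangent x := by simp only [mul_assoc, ← Finset.mul_sum, hV.tangent, mul_zero]

theorem SmoothOnSphere.div1 (hV : ∀ a, SmoothOnSphere fun x => V x a) :
    SmoothOnSphere fun x => div1 V x := by
  unfold NullInfinity.div1 covDeriv1; fun_prop

theorem integral_sum_mul_grad (hf : SmoothOnSphere f) (hV : IsOneForm V) :
    ∫ x, ∑ a, V x a * grad f x a ∂area = -∫ x, f x * div1 V x ∂area := by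
  have h := integral_div1 (hV.smul hf)
  simp only [div1_smul hf hV.smooth] at h
  rw [integral_add (hf.mul (.div1 hV.smooth)).integrable] at h
  · linarith
  · have := hV.smooth
    exact SmoothOnSphere.integrable (by fun_prop)

theorem integral_sum_mul_div2 (hV : IsOneForm V) (hT : IsTensor T) :
    ∫ x, ∑ b, V x b * div2 T x b ∂area = -∫ x, inner2 (covDeriv1 V x) (T x) ∂area := by
  have h := integral_div1 (hT.contract hV.smooth)
  simp only [div1_contract hT hV] at h
  rw [integral_add] at h
  · linarith
  · have := hV.smooth
    have := (isOneForm_div2 hT.smooth).smooth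
    exact SmoothOnSphere.integrable (by fun_prop)
  · have := (IsTensor.covDeriv1 hV.smooth).smooth
    have := hT.smooth
    unfold inner2
    exact SmoothOnSphere.integrable (by fun_prop)

end IntegrationByParts

/-! ### Symmetric traceless tensors and duality -/

/-- A smooth symmetric traceless 2-tensor on the sphere, in the ambient frame. -/
structure IsSTF (T : S2 → Fin 3 → Fin 3 → ℝ) : Prop where
  smooth : ∀ a b, SmoothOnSphere fun x => T x a b
  tangent : ∀ x a, ∑ b, T x a b * X b x = 0
  symm : ∀ x a b, T x a b = T x b a
  traceless : ∀ x, ∑ a, T x a a = 0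

/-- The dual `ε_a^e T_eb`; on symmetric traceless tensors it is an isometric complex structure,
which exchanges the closed and the co-closed parts of a shear tensor. -/
def dual (T : S2 → Fin 3 → Fin 3 → ℝ) (x : S2) (a b : Fin 3) : ℝ := ∑ e, epsilon x a e * T x e b

section Duality

variable {V W : S2 → Fin 3 → ℝ} {S T : S2 → Fin 3 → Fin 3 → ℝ} (x : S2) (a b : Fin 3)

theorem IsSTF.isTensor (hT : IsSTF T) : IsTensor T where
  smooth := hT.smooth
  tangent_left x b := by simpa only [hT.symm x b] using hT.tangent x b
  tangent_right := hT.tangent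

theorem IsSTF.dual_symm (hT : IsSTF T) : dual T x a b = dual T x b a := by
  have h : dual T x a b - dual T x b a
      = ∑ c, leviCivita a b c * (X c x * ∑ d, T x d d - ∑ d, T x c d * X d x) := by
    simp only [dual, epsilon, leviCivita, Fin.sum_univ_three, hT.symm x 1 0, hT.symm x 2 0,
      hT.symm x 2 1]
    fin_cases a <;> fin_cases b <;> simp [hT.symm x 1 0, hT.symm x 2 0, hT.symm x 2 1] <;> ring
  simpa only [hT.traceless, hT.tangent, mul_zero, sub_zero, Finset.sum_const_zero, sub_eq_zero]
    using h

theorem dual_dual (hT : IsSTF T) : dual (dual T) x a b = -T x a b := by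
  have htan : ∑ e, T x e b * X e x = 0 := hT.isTensor.tangent_left x b
  simp only [dual, Finset.mul_sum, ← mul_assoc]
  rw [Finset.sum_comm]
  simp only [← Finset.sum_mul, sum_epsilon_mul_epsilon, neg_mul, Finset.sum_neg_distrib,
    sum_sigma_mul_of_tangent x a htan]

theorem IsSTF.dual (hT : IsSTF T) : IsSTF (dual T) where
  smooth a b := by have := hT.smooth; unfold NullInfinity.dual; fun_prop
  tangent x a := by
    simp only [NullInfinity.dual, Finset.sum_mul, mul_assoc]
    rw [Finset.sum_comm]
    simp only [← Finset.mul_sum, hT.tangent, mul_zero, Finset.sum_const_zero]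
  symm := hT.dual_symm
  traceless x := by
    simp only [NullInfinity.dual, epsilon, leviCivita, Fin.sum_univ_three, hT.symm x 1 0,
      hT.symm x 2 0, hT.symm x 2 1]
    ring

theorem inner2_comm (M N : Fin 3 → Fin 3 → ℝ) : inner2 M N = inner2 N M := by
  simp only [inner2, mul_comm]

theorem inner2_dual_right : inner2 (S x) (dual T x) = -inner2 (dual S x) (T x) := by
  simp only [inner2, dual, epsilon, leviCivita, Fin.sum_univ_three]
  ring

theorem inner2_dual_dual (hT : IsSTF T) :
    inner2 (dual S x) (dual T x) = inner2 (S x) (T x) := by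
  have h := inner2_dual_right (S := S) (T := dual T) x
  have hdd : dual (dual T) x = fun a b => -T x a b := funext₂ fun a b => dual_dual x a b hT
  rw [hdd] at h
  simp only [inner2, mul_neg, Finset.sum_neg_distrib, neg_inj] at h
  exact h.symm

theorem contract_hodge (hT : IsSTF T) : contract T (hodge V) x a = -contract (dual T) V x a := by
  simp only [contract, hT.dual_symm x a]
  simp only [hodge, dual, hT.symm x a, epsilon, leviCivita, Fin.sum_univ_three]
  ring

theorem sum_hodge_mul_contract :
    ∑ a, hodge V x a * contract T W x a = -∑ a, V x a * contract (dual T) W x a := by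
  simp only [contract, hodge, dual, epsilon, leviCivita, Fin.sum_univ_three]
  ring

theorem sum_epsilon_mul_mul (hT : IsSTF T) :
    ∑ a, ∑ b, epsilon x a b * ∑ d, S x a d * T x d b = -inner2 (dual S x) (T x) := by
  simp only [inner2, dual, epsilon, leviCivita, Fin.sum_univ_three, hT.symm x 1 0, hT.symm x 2 0,
    hT.symm x 2 1]
  ring

/-- The area form is parallel. -/
theorem sum_sigma_mul_partialDeriv_epsilon_mul {v : S2 → Fin 3 → ℝ}
    (hv : ∀ e, SmoothOnSphere fun x => v x e) (htan : ∑ e, v x e * X e x = 0) :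
    ∑ c, sigma x b c * partialDeriv a (fun y => ∑ e, epsilon y c e * v y e) x
      = ∑ e, epsilon x b e * partialDeriv a (fun y => v y e) x := by
  have hgrad : ∀ c, HasGrad (fun y => ∑ e, epsilon y c e * v y e) _ := fun c =>
    .sum _ fun e _ => (hasGrad_epsilon c e).mul (.of_smooth (hv e))
  have hsplit : ∀ c, partialDeriv a (fun y => ∑ e, epsilon y c e * v y e) x
      = ∑ e, epsilon x c e * partialDeriv a (fun y => v y e) x
        + (X c x * ∑ e, v x e * epsilon x e a + epsilon x a c * ∑ e, v x e * X e x) := fun c => by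
    rw [(hgrad c).eq, Finset.mul_sum, Finset.mul_sum, ← Finset.sum_add_distrib,
      ← Finset.sum_add_distrib]
    exact Finset.sum_congr rfl fun e _ => by rw [grad]; ring
  simp only [hsplit, htan, mul_zero, add_zero, mul_add, Finset.sum_add_distrib]
  have hnormal : ∀ r, ∑ c, sigma x b c * (X c x * r) = 0 := fun r => by
    simp only [← mul_assoc, ← Finset.sum_mul, sum_sigma_mul_X, zero_mul]
  rw [hnormal, add_zero]
  simp only [Finset.mul_sum]
  rw [Finset.sum_comm]
  simp only [← mul_assoc, ← Finset.sum_mul, sum_sigma_mul_epsilon]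

theorem covDeriv1_hodge (hV : IsOneForm V) :
    covDeriv1 (hodge V) x a b = ∑ e, epsilon x b e * covDeriv1 V x a e := by
  simp only [covDeriv1, sum_mul_sum_sigma_mul x (sum_epsilon_mul_X x b)]
  exact sum_sigma_mul_partialDeriv_epsilon_mul x a b hV.smooth (hV.tangent x)

theorem div2_dual (hT : IsSTF T) : div2 (dual T) x b = hodge (div2 T) x b := by
  have hdual : ∀ a c, (fun y => dual T y a c) = fun y => ∑ e, epsilon y c e * T y e a :=
    fun a c => funext fun y => hT.dual_symm y a c
  simp only [div2_eq hT.dual.smooth, div2_eq hT.smooth, hodge, hdual,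
    sum_mul_sum_sigma_mul x (sum_epsilon_mul_X x b)]
  simp only [Finset.mul_sum]
  rw [Finset.sum_comm, Finset.sum_comm (f := fun e a => epsilon x b e * _)]
  refine Finset.sum_congr rfl fun a _ => ?_
  rw [sum_sigma_mul_partialDeriv_epsilon_mul x a b (fun e => hT.smooth e a)
    (hT.isTensor.tangent_left x a)]
  simp only [hT.symm _ a]

end Duality

/-! ### Boost and rotation fields -/

open NullInfinityData (rotation)

section ConformalKilling

variable {f : S2 → ℝ} {T C : S2 → Fin 3 → Fin 3 → ℝ} (k : Fin 3) (x : S2)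

theorem isOneForm_grad_X : IsOneForm (grad (X k)) := .grad (smooth_X k)

theorem isOneForm_rotation : IsOneForm (rotation k) := (isOneForm_grad_X k).hodge

theorem sum_grad_X_mul {v : Fin 3 → ℝ} (hv : ∑ a, v a * X a x = 0) :
    ∑ a, grad (X k) x a * v a = v k := by
  rw [(HasGrad.coord k).grad_eq, ← sum_sigma_mul_of_tangent x k hv]
  simp only [sigma_symm x _ k]

theorem covDeriv1_grad_X (a b : Fin 3) : covDeriv1 (grad (X k)) x a b = -X k x * sigma x a b := by
  have hsplit : ∀ c, sigma x b c * -(X c x * sigma x a k + X k x * sigma x a c)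
      = -sigma x a k * (sigma x b c * X c x) - X k x * (sigma x b c * sigma x c a) := fun c => by
    rw [sigma_symm x c a]; ring
  have htan : ∑ c, sigma x c a * X c x = 0 := sum_sigma_mul_X_left x a
  simp only [covDeriv1, (HasGrad.coord k).grad_eq, (hasGrad_sigma _ k).eq, hsplit,
    Finset.sum_sub_distrib, ← Finset.mul_sum, sum_sigma_mul_X,
    sum_sigma_mul_of_tangent x b htan, sigma_symm x b a]
  ring

theorem covDeriv1_rotation (a b : Fin 3) :
    covDeriv1 (rotation k) x a b = X k x * epsilon x a b := by
  refine (covDeriv1_hodge x a b (isOneForm_grad_X k)).trans ?_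
  simp only [covDeriv1_grad_X, epsilon_antisymm x a b, ← sum_epsilon_mul_sigma x b a,
    sigma_symm x a, mul_neg, Finset.mul_sum, neg_mul, Finset.sum_neg_distrib]
  simp only [mul_left_comm]

theorem div1_grad_X : div1 (grad (X k)) x = -2 * X k x := by
  simp only [div1, covDeriv1_grad_X, ← Finset.mul_sum, sum_sigma_self]
  ring

theorem div1_rotation : div1 (rotation k) x = 0 := by
  simp only [div1, covDeriv1_rotation, ← Finset.mul_sum]
  simp [epsilon, leviCivita]

theorem integral_grad_X_mul_grad (hf : SmoothOnSphere f) :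
    ∫ x, ∑ a, grad (X k) x a * grad f x a ∂area = 2 * ∫ x, X k x * f x ∂area := by
  rw [integral_sum_mul_grad hf (isOneForm_grad_X k), ← integral_const_mul, ← integral_neg]
  exact integral_congr_ae <| .of_forall fun x => by simp only [div1_grad_X]; ring

theorem integral_rotation_mul_grad (hf : SmoothOnSphere f) :
    ∫ x, ∑ a, rotation k x a * grad f x a ∂area = 0 := by
  simp only [integral_sum_mul_grad hf (isOneForm_rotation k), div1_rotation, mul_zero,
    integral_zero, neg_zero]

theorem integral_grad_X_mul_div2 (hT : IsTensor T) :
    ∫ x, ∑ b, grad (X k) x b * div2 T x b ∂area = ∫ x, X k x * ∑ a, T x a a ∂area := by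
  rw [integral_sum_mul_div2 (isOneForm_grad_X k) hT, ← integral_neg]
  refine integral_congr_ae <| .of_forall fun x => ?_
  have h : ∀ a, ∑ b, sigma x a b * T x a b = T x a a := fun a =>
    sum_sigma_mul_of_tangent x a (hT.tangent_right x a)
  simp only [inner2, covDeriv1_grad_X, mul_assoc, ← Finset.mul_sum, h]
  ring

theorem integral_rotation_mul_div2 (hT : IsTensor T) :
    ∫ x, ∑ b, rotation k x b * div2 T x b ∂area
      = -∫ x, X k x * ∑ a, ∑ b, epsilon x a b * T x a b ∂area := by
  rw [integral_sum_mul_div2 (isOneForm_rotation k) hT]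
  simp only [inner2, covDeriv1_rotation, mul_assoc, Finset.mul_sum]

theorem integral_X_mul_div1_div2 (hC : IsSTF C) :
    ∫ x, X k x * div1 (div2 C) x ∂area = 0 := by
  have hparts := integral_sum_mul_grad (smooth_X k) (isOneForm_div2 hC.smooth)
  have hzero := integral_grad_X_mul_div2 k hC.isTensor
  simp only [mul_comm (div2 C _ _), hzero, hC.traceless, mul_zero, integral_zero] at hparts
  linarith

theorem integral_X_mul_curl_div2 (hC : IsSTF C) :
    ∫ x, X k x * ∑ a, ∑ b, epsilon x a b * covDeriv1 (div2 C) x a b ∂area = 0 := by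
  rw [← integral_X_mul_div1_div2 k hC.dual]
  simp only [funext₂ (div2_dual · · hC), div1, covDeriv1_hodge _ _ _ (isOneForm_div2 hC.smooth)]

end ConformalKilling

/-! ### Moments of the evolution equation of the angular momentum aspect -/

/-- The right-hand side of the evolution equation of the angular momentum aspect, for the mass
aspect `m`, the shear `C` and the news `N`. -/
def aspectRate (m : S2 → ℝ) (C N : S2 → Fin 3 → Fin 3 → ℝ) (x : S2) (a : Fin 3) : ℝ :=
  grad m x a
    - 1 / 4 * div2 (fun y d e => covDeriv1 (div2 C) y d e - covDeriv1 (div2 C) y e d) x a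
    + 1 / 4 * grad (fun y => inner2 (C y) (N y)) x a
    - 1 / 4 * div2 (fun y b e => ∑ d, C y b d * N y d e) x a
    + 1 / 2 * contract C (div2 N) x a

section AspectRate

variable {m : S2 → ℝ} {V : S2 → Fin 3 → ℝ} {S T C N : S2 → Fin 3 → Fin 3 → ℝ} (k : Fin 3)

theorem IsTensor.transpose (hT : IsTensor T) : IsTensor fun x a b => T x b a :=
  ⟨fun a b => hT.smooth b a, hT.tangent_right, hT.tangent_left⟩

theorem IsTensor.sub (hS : IsTensor S) (hT : IsTensor T) :
    IsTensor fun x a b => S x a b - T x a b where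
  smooth a b := (hS.smooth a b).sub (hT.smooth a b)
  tangent_left x b := by
    simp only [sub_mul, Finset.sum_sub_distrib, hS.tangent_left, hT.tangent_left, sub_zero]
  tangent_right x a := by
    simp only [sub_mul, Finset.sum_sub_distrib, hS.tangent_right, hT.tangent_right, sub_zero]

theorem IsTensor.mul (hS : IsTensor S) (hT : IsTensor T) :
    IsTensor fun x a b => ∑ d, S x a d * T x d b where
  smooth a b := by have := hS.smooth; have := hT.smooth; fun_prop
  tangent_left x b := sum_sum_mul_eq_zero (hS.tangent_left x) fun d => T x d b
  tangent_right x a := by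
    simpa only [mul_comm (S x a _)] using
      sum_sum_mul_eq_zero (M := fun b d => T x d b) (hT.tangent_right x) (S x a)

theorem smooth_inner2 (hS : ∀ a b, SmoothOnSphere fun x => S x a b)
    (hT : ∀ a b, SmoothOnSphere fun x => T x a b) :
    SmoothOnSphere fun x => inner2 (S x) (T x) := by
  unfold inner2; fun_prop

theorem IsSTF.isTensor_curl_div2 (hC : IsSTF C) :
    IsTensor fun x a b => covDeriv1 (div2 C) x a b - covDeriv1 (div2 C) x b a :=
  have h : IsTensor (covDeriv1 (div2 C)) := .covDeriv1 (isOneForm_div2 hC.smooth).smooth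
  h.sub h.transpose

theorem integral_sum_mul_aspectRate (hm : SmoothOnSphere m) (hC : IsSTF C) (hN : IsSTF N)
    (hV : IsOneForm V) :
    ∫ x, ∑ a, V x a * aspectRate m C N x a ∂area =
      ∫ x, ∑ a, V x a * grad m x a ∂area
      - 1 / 4 * ∫ x, ∑ a, V x a *
          div2 (fun y d e => covDeriv1 (div2 C) y d e - covDeriv1 (div2 C) y e d) x a ∂area
      + 1 / 4 * ∫ x, ∑ a, V x a * grad (fun y => inner2 (C y) (N y)) x a ∂area
      - 1 / 4 * ∫ x, ∑ a, V x a * div2 (fun y b e => ∑ d, C y b d * N y d e) x a ∂area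
      + 1 / 2 * ∫ x, ∑ a, V x a * contract C (div2 N) x a ∂area := by
  have hVs := hV.smooth
  have hsplit : ∀ {r s t v w : S2 → Fin 3 → ℝ}, (∀ a, SmoothOnSphere fun x => r x a) →
      (∀ a, SmoothOnSphere fun x => s x a) → (∀ a, SmoothOnSphere fun x => t x a) →
      (∀ a, SmoothOnSphere fun x => v x a) → (∀ a, SmoothOnSphere fun x => w x a) →
      ∫ x, ∑ a, V x a *
          (r x a - 1 / 4 * s x a + 1 / 4 * t x a - 1 / 4 * v x a + 1 / 2 * w x a) ∂area =
        ∫ x, ∑ a, V x a * r x a ∂area - 1 / 4 * ∫ x, ∑ a, V x a * s x a ∂area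
          + 1 / 4 * ∫ x, ∑ a, V x a * t x a ∂area - 1 / 4 * ∫ x, ∑ a, V x a * v x a ∂area
          + 1 / 2 * ∫ x, ∑ a, V x a * w x a ∂area := fun hr hs ht hv hw => by
    simp only [mul_add, mul_sub, Finset.sum_add_distrib, Finset.sum_sub_distrib,
      mul_left_comm (V _ _), ← Finset.mul_sum]
    rw [integral_add, integral_sub, integral_add, integral_sub]
    · simp only [integral_const_mul]
    all_goals exact SmoothOnSphere.integrable (by fun_prop)
  exact hsplit (IsOneForm.grad hm).smooth (isOneForm_div2 hC.isTensor_curl_div2.smooth).smooth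
    (IsOneForm.grad (smooth_inner2 hC.smooth hN.smooth)).smooth
    (isOneForm_div2 (hC.isTensor.mul hN.isTensor).smooth).smooth
    (hC.isTensor.contract (isOneForm_div2 hN.smooth).smooth).smooth

theorem integral_grad_X_mul_aspectRate (hm : SmoothOnSphere m) (hC : IsSTF C) (hN : IsSTF N) :
    ∫ x, ∑ a, grad (X k) x a * aspectRate m C N x a ∂area =
      2 * ∫ x, X k x * m x ∂area + 1 / 4 * ∫ x, X k x * inner2 (C x) (N x) ∂area
        + 1 / 2 * ∫ x, ∑ a, grad (X k) x a * contract C (div2 N) x a ∂area := by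
  have hmul : ∀ x, ∑ a, ∑ d, C x a d * N x d a = inner2 (C x) (N x) := fun x => by
    simp only [inner2, hN.symm x]
  rw [integral_sum_mul_aspectRate hm hC hN (isOneForm_grad_X k), integral_grad_X_mul_grad k hm,
    integral_grad_X_mul_grad k (smooth_inner2 hC.smooth hN.smooth),
    integral_grad_X_mul_div2 k hC.isTensor_curl_div2,
    integral_grad_X_mul_div2 k (hC.isTensor.mul hN.isTensor)]
  simp only [sub_self, Finset.sum_const_zero, mul_zero, integral_zero, hmul]
  ring

theorem integral_rotation_mul_aspectRate (hm : SmoothOnSphere m) (hC : IsSTF C) (hN : IsSTF N) :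
    ∫ x, ∑ a, rotation k x a * aspectRate m C N x a ∂area =
      -(1 / 4) * ∫ x, X k x * inner2 (dual C x) (N x) ∂area
        + 1 / 2 * ∫ x, ∑ a, rotation k x a * contract C (div2 N) x a ∂area := by
  have hcurl : ∀ x, ∑ a, ∑ b, epsilon x a b *
      (covDeriv1 (div2 C) x a b - covDeriv1 (div2 C) x b a)
        = 2 * ∑ a, ∑ b, epsilon x a b * covDeriv1 (div2 C) x a b := fun x => by
    simp only [epsilon, leviCivita, Fin.sum_univ_three]
    ring
  rw [integral_sum_mul_aspectRate hm hC hN (isOneForm_rotation k),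
    integral_rotation_mul_grad k hm,
    integral_rotation_mul_grad k (smooth_inner2 hC.smooth hN.smooth),
    integral_rotation_mul_div2 k hC.isTensor_curl_div2,
    integral_rotation_mul_div2 k (hC.isTensor.mul hN.isTensor)]
  simp only [hcurl, mul_left_comm (X k _) 2, integral_const_mul, integral_X_mul_curl_div2 k hC,
    sum_epsilon_mul_mul _ hN, mul_neg, integral_neg]
  ring

end AspectRate

/-! ### Second derivatives -/

section SecondDerivatives

variable {f : S2 → ℝ} (x : S2) (a b : Fin 3)

theorem partialDeriv_partialDeriv (hf : SmoothOnSphere f) :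
    partialDeriv a (partialDeriv b f) x = X a x * partialDeriv b f x
      + fderiv ℝ (fderiv ℝ (radialExt f)) x (EuclideanSpace.single a 1)
          (EuclideanSpace.single b 1) := by
  have hD : DifferentiableAt ℝ (fderiv ℝ (radialExt f)) (x : E3) :=
    ((hf.contDiffAt (compl_zero_mem_nhds x)).fderiv_right (m := 1)
      (WithTop.coe_le_coe.2 le_top)).differentiableAt (by simp)
  have hprod := (hasFDerivAt_norm_coe x).mul
    (hD.hasFDerivAt.clm_apply (hasFDerivAt_const (EuclideanSpace.single b (1 : ℝ)) (x : E3)))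
  have hext : radialExt (partialDeriv b f) =ᶠ[nhds (x : E3)] fun y =>
      ‖y‖ * fderiv ℝ (radialExt f) y (EuclideanSpace.single b 1) :=
    Filter.eventually_of_mem (compl_zero_mem_nhds x) fun _ hy => radialExt_partialDeriv f b hy
  have hX : innerSL ℝ (x : E3) (EuclideanSpace.single a 1) = X a x := by
    simp [X, EuclideanSpace.inner_single_right]
  rw [partialDeriv, hext.fderiv_eq]
  refine (congrArg (· (EuclideanSpace.single a 1)) hprod.fderiv).trans ?_
  simp [hX, partialDeriv, add_comm, mul_comm]

theorem partialDeriv_comm (hf : SmoothOnSphere f) :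
    partialDeriv a (partialDeriv b f) x - X a x * partialDeriv b f x
      = partialDeriv b (partialDeriv a f) x - X b x * partialDeriv a f x := by
  have hsymm : IsSymmSndFDerivAt ℝ (radialExt f) (x : E3) :=
    (hf.contDiffAt (compl_zero_mem_nhds x)).isSymmSndFDerivAt
      (by simpa using WithTop.coe_le_coe.2 (le_top (a := (2 : ℕ∞))))
  rw [partialDeriv_partialDeriv x a b hf, partialDeriv_partialDeriv x b a hf, hsymm.eq,
    add_sub_cancel_left, add_sub_cancel_left]

theorem sum_X_mul_partialDeriv_partialDeriv (hf : SmoothOnSphere f) :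
    ∑ b, X b x * partialDeriv a (partialDeriv b f) x = -partialDeriv a f x := by
  have hgrad : HasGrad (fun y => ∑ b, X b y * partialDeriv b f y) _ :=
    .sum _ fun b _ => (HasGrad.coord b).mul (.of_smooth (hf.partialDeriv b))
  have h := hgrad.eq a x
  simp only [sum_X_mul_partialDeriv _ hf, (HasGrad.const 0).eq a x, Finset.sum_add_distrib,
    mul_comm (partialDeriv _ f x), sum_sigma_mul_partialDeriv hf, grad] at h
  exact eq_neg_of_add_eq_zero_left h.symm

theorem hess_eq (hf : SmoothOnSphere f) :
    hess f x a b = partialDeriv a (partialDeriv b f) x + X b x * partialDeriv a f x := by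
  refine (sum_sigma_mul x b fun c => partialDeriv a (partialDeriv c f) x).trans ?_
  rw [sum_X_mul_partialDeriv_partialDeriv x a hf]
  ring

theorem hess_symm (hf : SmoothOnSphere f) : hess f x a b = hess f x b a := by
  rw [hess_eq x a b hf, hess_eq x b a hf]
  linarith [partialDeriv_comm x a b hf]

theorem isTensor_hess (hf : SmoothOnSphere f) : IsTensor (hess f) := .covDeriv1 hf.grad

theorem smooth_laplacian (hf : SmoothOnSphere f) : SmoothOnSphere (laplacian f) := .div1 hf.grad

theorem isSTF_closedPart (hf : SmoothOnSphere f) : IsSTF (closedPart f) where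
  smooth a b := by
    have := (isTensor_hess hf).smooth
    have := smooth_laplacian hf
    unfold closedPart
    fun_prop
  tangent x a := by
    have h : ∀ b, 1 / 2 * sigma x a b * laplacian f x * X b x
        = 1 / 2 * laplacian f x * (sigma x a b * X b x) := fun b => by ring
    simp only [closedPart, sub_mul, Finset.sum_sub_distrib, (isTensor_hess hf).tangent_right, h,
      ← Finset.mul_sum, sum_sigma_mul_X, mul_zero, sub_zero]
  symm x a b := by rw [closedPart, closedPart, hess_symm x a b hf, sigma_symm]
  traceless x := by
    simp only [closedPart, Finset.sum_sub_distrib, ← Finset.sum_mul, ← Finset.mul_sum,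
      sum_sigma_self, laplacian]
    ring

theorem coclosedPart_eq_dual (hf : SmoothOnSphere f) : coclosedPart f = dual (closedPart f) := by
  have h : ∀ x a b, ∑ e, epsilon x a e * hess f x e b
      = dual (closedPart f) x a b + 1 / 2 * laplacian f x * epsilon x a b := fun x a b => by
    rw [← sum_epsilon_mul_sigma x a b, Finset.mul_sum, dual, ← Finset.sum_add_distrib]
    exact Finset.sum_congr rfl fun e _ => by rw [closedPart]; ring
  ext x a b
  rw [coclosedPart, Finset.sum_add_distrib, h, h, epsilon_antisymm x b a,
    (isSTF_closedPart hf).dual_symm x b a]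
  ring

theorem sum_partialDeriv_closedPart (hf : SmoothOnSphere f) :
    ∑ a, partialDeriv a (fun y => closedPart f y a b) x
      = 1 / 2 * partialDeriv b (laplacian f) x + partialDeriv b f x := by
  have hterm : ∀ a, partialDeriv a (fun y => closedPart f y a b) x
      = partialDeriv b (partialDeriv a (partialDeriv a f)) x
        + X a x * partialDeriv b (partialDeriv a f) x
        - X b x * partialDeriv a (partialDeriv a f) x
        + X a x * partialDeriv a (partialDeriv b f) x
        + partialDeriv b f x * sigma x a a
        - 1 / 2 * (sigma x b a * partialDeriv a (laplacian f) x)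
        + 1 / 2 * laplacian f x * (X b x * sigma x a a)
        + 1 / 2 * laplacian f x * (sigma x b a * X a x) := fun a => by
    have hclosed : (fun y => closedPart f y a b) = fun y => partialDeriv b (partialDeriv a f) y
        + X a y * partialDeriv b f y - 1 / 2 * sigma y a b * laplacian f y :=
      funext fun y => by rw [closedPart, hess_symm y a b hf, hess_eq y b a hf]
    rw [hclosed, ((HasGrad.of_smooth ((hf.partialDeriv a).partialDeriv b)).add
      ((HasGrad.coord a).mul (.of_smooth (hf.partialDeriv b)))).sub
      (((hasGrad_sigma a b).const_mul (1 / 2)).mul (.of_smooth (smooth_laplacian hf))) |>.eq,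
      sigma_symm x b a]
    simp only [grad]
    linear_combination partialDeriv_comm x a b (hf.partialDeriv a)
  have hΔ : laplacian f = fun y => ∑ a, partialDeriv a (partialDeriv a f) y :=
    funext fun y => div1_eq hf.grad y
  have hgradΔ : ∑ a, partialDeriv b (partialDeriv a (partialDeriv a f)) x
      = partialDeriv b (laplacian f) x := by
    rw [hΔ]
    exact ((HasGrad.sum _ fun a _ => .of_smooth ((hf.partialDeriv a).partialDeriv a)).eq b x).symm
  simp only [hterm, Finset.sum_add_distrib, Finset.sum_sub_distrib, ← Finset.mul_sum, hgradΔ,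
    sum_X_mul_partialDeriv_partialDeriv x b hf, sum_X_mul_partialDeriv x (hf.partialDeriv b),
    sum_sigma_self, sum_sigma_mul_partialDeriv (smooth_laplacian hf), sum_sigma_mul_X]
  rw [congrFun hΔ x]
  ring

/-- Commuting derivatives produces the curvature term `∇f`. -/
theorem div2_closedPart (hf : SmoothOnSphere f) :
    div2 (closedPart f) x b = 1 / 2 * grad (laplacian f) x b + grad f x b := by
  simp only [div2_eq (isSTF_closedPart hf).smooth, sum_partialDeriv_closedPart x _ hf, mul_add,
    Finset.sum_add_distrib, mul_left_comm (sigma x b _), ← Finset.mul_sum,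
    sum_sigma_mul_partialDeriv hf, sum_sigma_mul_partialDeriv (smooth_laplacian hf), grad]

end SecondDerivatives

/-! ### Parity under the antipodal map -/

section Parity

variable {f : S2 → ℝ} (x : S2) (a b : Fin 3)

theorem X_neg : X a (-x) = -X a x := rfl

theorem epsilon_neg : epsilon (-x) a b = -epsilon x a b := by
  simp only [epsilon, X_neg, mul_neg, Finset.sum_neg_distrib]

theorem sigma_neg : sigma (-x) a b = sigma x a b := by
  simp only [sigma, X_neg, neg_mul_neg]

theorem radialExt_neg {s : ℝ} (hf : ∀ x, f (-x) = s * f x) (y : E3) :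
    radialExt f (-y) = s * radialExt f y := by
  rcases eq_or_ne y 0 with rfl | hy
  · simp [radialExt]
  · obtain ⟨x, hx⟩ := exists_eq_norm_smul_coe hy
    have hpos : 0 < ‖y‖ := norm_pos_iff.2 hy
    have hneg : -(x : E3) = ((-x : S2) : E3) := rfl
    rw [hx, ← smul_neg, radialExt_smul f _ hpos, radialExt_smul f _ hpos, hneg, radialExt_coe,
      radialExt_coe, hf]

theorem partialDeriv_neg {s : ℝ} (hf : ∀ x, f (-x) = s * f x) :
    partialDeriv a f (-x) = -s * partialDeriv a f x := by
  have hext : (fun y => radialExt f ((-1 : ℝ) • y)) = s • radialExt f :=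
    funext fun y => by rw [neg_one_smul, radialExt_neg hf, Pi.smul_apply, smul_eq_mul]
  have h := fderiv_comp_smul (𝕜 := ℝ) (-1) (f := radialExt f) (x := (x : E3))
  rw [hext, fderiv_const_smul_field, neg_one_smul, neg_one_smul, Pi.smul_apply] at h
  have hneg : ((-x : S2) : E3) = -(x : E3) := rfl
  rw [partialDeriv, hneg, partialDeriv, neg_mul, ← smul_eq_mul, ← smul_apply, h, neg_apply, neg_neg]

theorem grad_neg_of_even (hf : Function.Even f) : grad f (-x) a = -grad f x a := by
  simpa [grad] using partialDeriv_neg (s := 1) x a fun y => by rw [hf y, one_mul]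

theorem closedPart_neg_of_even (hf : Function.Even f) (hfs : SmoothOnSphere f) :
    closedPart f (-x) a b = closedPart f x a b := by
  have hess_even : ∀ a b, hess f (-x) a b = hess f x a b := fun a b => by
    have hsecond : partialDeriv a (partialDeriv b f) (-x)
        = partialDeriv a (partialDeriv b f) x := by
      simpa using partialDeriv_neg (s := -1) x a fun y =>
        (grad_neg_of_even y b hf).trans (neg_one_mul _).symm
    have hfirst : partialDeriv a f (-x) = -partialDeriv a f x := grad_neg_of_even x a hf
    rw [hess_eq _ a b hfs, hess_eq x a b hfs, X_neg, hsecond, hfirst, neg_mul_neg]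
  simp only [closedPart, laplacian, hess_even, sigma_neg]

end Parity

/-! ### Shear tensors with `ℓ = 2` potentials -/

/-- A spherical harmonic of mode `2`. Its evenness, although a consequence of the eigenvalue
equation, is recorded as a field, because it is evident for the quadratic forms in question. -/
structure IsModeTwo (f : S2 → ℝ) : Prop where
  smooth : SmoothOnSphere f
  laplacian_eq : ∀ x, laplacian f x = -6 * f x
  even : Function.Even f

/-- The shear tensor with closed potential `f` and co-closed potential `g`. -/
def shearTensor (f g : S2 → ℝ) (x : S2) (a b : Fin 3) : ℝ :=
  closedPart f x a b + coclosedPart g x a b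

/-- The derivative along the rotation field `ε^{AB} ∇_B X^k`. -/
def rotDeriv (k : Fin 3) (f : S2 → ℝ) (x : S2) : ℝ := ∑ a, rotation k x a * grad f x a

/-- The `L²` pairing of `f` with the derivative of `g` along the `k`-th rotation field; the fluxes
of angular momentum and of the center of mass are expressed in it. -/
def rotPairing (k : Fin 3) (f g : S2 → ℝ) : ℝ := ∫ x, f x * rotDeriv k g x ∂area

section Algebra

variable {f g φ : S2 → ℝ} {S T : S2 → Fin 3 → Fin 3 → ℝ} (k : Fin 3) (x : S2) (a b : Fin 3)

theorem sum_hodge_mul (V W : S2 → Fin 3 → ℝ) :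
    ∑ a, hodge V x a * W x a = -∑ a, V x a * hodge W x a := by
  simp only [hodge, Finset.sum_mul, Finset.mul_sum, ← Finset.sum_neg_distrib]
  rw [Finset.sum_comm]
  refine Finset.sum_congr rfl fun a _ => Finset.sum_congr rfl fun b _ => ?_
  rw [epsilon_antisymm x b a]
  ring

theorem grad_neg (hf : SmoothOnSphere f) : grad (-f) x a = -grad f x a := by
  have hneg : -f = fun x => -1 * f x := funext fun x => (neg_one_mul (f x)).symm
  rw [hneg, ((HasGrad.of_smooth hf).const_mul (-1)).grad_eq]
  exact neg_one_mul _

theorem hess_neg (hf : SmoothOnSphere f) : hess (-f) x a b = -hess f x a b := by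
  have h : ∀ c, partialDeriv a (fun y => grad (-f) y c) x
      = -partialDeriv a (fun y => grad f y c) x := fun c =>
    (congrArg (partialDeriv a · x) (funext fun y => grad_neg y c hf)).trans
      (grad_neg x a (hf.grad c))
  simp only [hess, covDeriv1, h, mul_neg, Finset.sum_neg_distrib]

theorem closedPart_neg (hf : SmoothOnSphere f) : closedPart (-f) x a b = -closedPart f x a b := by
  simp only [closedPart, laplacian, hess_neg x _ _ hf, Finset.sum_neg_distrib]
  ring

theorem IsModeTwo.neg (hf : IsModeTwo f) : IsModeTwo (-f) where
  smooth := by simpa [Pi.neg_def] using ((HasGrad.of_smooth hf.smooth).const_mul (-1)).smooth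
  laplacian_eq x := by
    have h := hf.laplacian_eq x
    simp only [laplacian, hess_neg x _ _ hf.smooth, Finset.sum_neg_distrib, Pi.neg_apply] at h ⊢
    linarith
  even x := by rw [Pi.neg_apply, hf.even, Pi.neg_apply]

theorem IsModeTwo.div2_closedPart (hf : IsModeTwo f) :
    div2 (closedPart f) x b = -2 * grad f x b := by
  rw [NullInfinity.div2_closedPart x b hf.smooth, funext hf.laplacian_eq,
    ((HasGrad.of_smooth hf.smooth).const_mul (-6)).grad_eq]
  ring

theorem IsSTF.add (hS : IsSTF S) (hT : IsSTF T) : IsSTF fun x a b => S x a b + T x a b where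
  smooth a b := (hS.smooth a b).add (hT.smooth a b)
  tangent x a := by simp only [add_mul, Finset.sum_add_distrib, hS.tangent, hT.tangent, add_zero]
  symm x a b := by rw [hS.symm, hT.symm]
  traceless x := by simp only [Finset.sum_add_distrib, hS.traceless, hT.traceless, add_zero]

theorem shearTensor_eq (hg : SmoothOnSphere g) :
    shearTensor f g = fun x a b => closedPart f x a b + dual (closedPart g) x a b := by
  rw [← coclosedPart_eq_dual hg]; rfl

theorem isSTF_shearTensor (hf : SmoothOnSphere f) (hg : SmoothOnSphere g) :
    IsSTF (shearTensor f g) := by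
  rw [shearTensor_eq hg]
  exact (isSTF_closedPart hf).add (isSTF_closedPart hg).dual

theorem dual_shearTensor (hf : SmoothOnSphere f) (hg : SmoothOnSphere g) :
    dual (shearTensor f g) = shearTensor (-g) f := by
  ext x a b
  have hsplit : dual (shearTensor f g) x a b
      = dual (closedPart f) x a b + dual (dual (closedPart g)) x a b := by
    rw [shearTensor_eq hg]
    simp only [dual, mul_add, Finset.sum_add_distrib]
  simp only [hsplit, dual_dual x a b (isSTF_closedPart hg), shearTensor_eq hf,
    closedPart_neg x a b hg]
  exact add_comm _ _

theorem div2_shearTensor (hf : IsModeTwo f) (hg : IsModeTwo g) :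
    div2 (shearTensor f g) x b = -2 * (grad f x b + hodge (grad g) x b) := by
  have hadd : div2 (shearTensor f g) x b
      = div2 (closedPart f) x b + div2 (dual (closedPart g)) x b := by
    have hS := isSTF_closedPart hf.smooth
    have hT := (isSTF_closedPart hg.smooth).dual
    rw [shearTensor_eq hg.smooth, div2_eq (hS.add hT).smooth, div2_eq hS.smooth, div2_eq hT.smooth,
      ← Finset.sum_add_distrib]
    refine Finset.sum_congr rfl fun c _ => ?_
    rw [← mul_add, ← Finset.sum_add_distrib]
    exact congrArg _ (Finset.sum_congr rfl fun a _ =>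
      ((HasGrad.of_smooth (hS.smooth a c)).add (.of_smooth (hT.smooth a c))).eq a x)
  have hhodge : hodge (div2 (closedPart g)) x b = -2 * hodge (grad g) x b := by
    simp only [hodge, hg.div2_closedPart, Finset.mul_sum, mul_left_comm]
  rw [hadd, hf.div2_closedPart, div2_dual x b (isSTF_closedPart hg.smooth), hhodge]
  ring

theorem IsSTF.inner2_closedPart (hT : IsSTF T) :
    inner2 (T x) (closedPart f x) = inner2 (T x) (hess f x) := by
  have hσ : ∀ a, ∑ b, T x a b * sigma x a b = T x a a := fun a => by
    simp only [mul_comm (T x a _)]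
    exact sum_sigma_mul_of_tangent x a (hT.tangent x a)
  have hsplit : ∀ a b, T x a b * closedPart f x a b
      = T x a b * hess f x a b - 1 / 2 * laplacian f x * (T x a b * sigma x a b) := fun a b => by
    rw [closedPart]; ring
  simp only [inner2, hsplit, Finset.sum_sub_distrib, ← Finset.mul_sum, hσ, hT.traceless, mul_zero,
    sub_zero]

theorem inner2_shearTensor (hT : IsSTF T) (hg : SmoothOnSphere g) :
    inner2 (T x) (shearTensor f g x) = inner2 (T x) (hess f x) - inner2 (dual T x) (hess g x) := by
  rw [← hT.inner2_closedPart, ← hT.dual.inner2_closedPart, shearTensor_eq hg, sub_eq_add_neg,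
    ← inner2_dual_right]
  simp only [inner2, mul_add, Finset.sum_add_distrib]

theorem div1_hodge_grad (hf : SmoothOnSphere f) : div1 (hodge (grad f)) x = 0 := by
  have hcurl : ∑ a, ∑ b, epsilon x a b * hess f x a b
      = -∑ a, ∑ b, epsilon x a b * hess f x a b := by
    conv_lhs => rw [Finset.sum_comm]
    simp only [← Finset.sum_neg_distrib]
    refine Finset.sum_congr rfl fun a _ => Finset.sum_congr rfl fun b _ => ?_
    rw [epsilon_antisymm x b a, hess_symm x b a hf, neg_mul]
  simp only [div1, covDeriv1_hodge x _ _ (IsOneForm.grad hf)]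
  exact self_eq_neg.1 hcurl

end Algebra

section Pairings

variable {f f' g g' h φ : S2 → ℝ} {T : S2 → Fin 3 → Fin 3 → ℝ} (k : Fin 3)

theorem integral_mul_grad_X_mul_grad_eq_zero (hφ : Function.Even φ) (hf : Function.Even f)
    (hfs : SmoothOnSphere f) : ∫ x, φ x * ∑ a, grad (X k) x a * grad f x a ∂area = 0 :=
  integral_toSphere_eq_zero_of_odd fun x => by
    rw [sum_grad_X_mul k _ ((IsOneForm.grad hfs).tangent _),
      sum_grad_X_mul k _ ((IsOneForm.grad hfs).tangent _), hφ, grad_neg_of_even x k hf, mul_neg]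

theorem integral_X_mul_grad_mul_grad_eq_zero (hφ : Function.Even φ) (hf : Function.Even f) :
    ∫ x, X k x * ∑ a, grad φ x a * grad f x a ∂area = 0 :=
  integral_toSphere_eq_zero_of_odd fun x => by
    simp only [X_neg, grad_neg_of_even x _ hφ, grad_neg_of_even x _ hf, neg_mul, mul_neg, neg_neg]

theorem smooth_rotDeriv (hf : SmoothOnSphere f) : SmoothOnSphere (rotDeriv k f) := by
  have := (isOneForm_rotation k).smooth
  unfold rotDeriv
  fun_prop

theorem rotPairing_antisymm (hf : SmoothOnSphere f) (hg : SmoothOnSphere g) :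
    rotPairing k f g = -rotPairing k g f := by
  have hprod := (HasGrad.of_smooth hf).mul (.of_smooth hg)
  have hsum : rotPairing k f g + rotPairing k g f = 0 := by
    rw [rotPairing, rotPairing, ← integral_add (hf.mul (smooth_rotDeriv k hg)).integrable
      (hg.mul (smooth_rotDeriv k hf)).integrable, ← integral_rotation_mul_grad k (hf.mul hg)]
    refine integral_congr_ae <| .of_forall fun x => ?_
    simp only [rotDeriv, hprod.grad_eq, mul_add, Finset.sum_add_distrib, Finset.mul_sum,
      mul_left_comm]
  exact eq_neg_of_add_eq_zero_left hsum

theorem rotPairing_neg_right (hg : SmoothOnSphere g) :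
    rotPairing k f (-g) = -rotPairing k f g := by
  simp only [rotPairing, rotDeriv, grad_neg _ _ hg, mul_neg, Finset.sum_neg_distrib, integral_neg]

theorem integral_grad_mul_hodge_grad (hφ : SmoothOnSphere φ) (hg : SmoothOnSphere g) :
    ∫ x, ∑ a, grad φ x a * hodge (grad g) x a ∂area = 0 := by
  simp only [mul_comm (grad φ _ _)]
  rw [integral_sum_mul_grad hφ (IsOneForm.grad hg).hodge]
  simp only [div1_hodge_grad _ hg, mul_zero, integral_zero, neg_zero]

theorem IsModeTwo.integral_grad_mul_grad (hf : IsModeTwo f) (hφ : SmoothOnSphere φ) :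
    ∫ x, ∑ a, grad φ x a * grad f x a ∂area = 6 * ∫ x, φ x * f x ∂area := by
  simp only [mul_comm (grad φ _ _)]
  rw [integral_sum_mul_grad hφ (.grad hf.smooth), ← integral_neg, ← integral_const_mul]
  refine integral_congr_ae <| .of_forall fun x => ?_
  change -(φ x * laplacian f x) = _
  rw [hf.laplacian_eq]
  ring

theorem sum_grad_X_mul_hodge_grad (x : S2) :
    ∑ a, grad (X k) x a * hodge (grad g) x a = -rotDeriv k g x := by
  rw [← neg_eq_iff_eq_neg, ← sum_hodge_mul]
  rfl

theorem integral_X_mul_grad_mul_hodge_grad (hφ : SmoothOnSphere φ) (hg : SmoothOnSphere g) :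
    ∫ x, X k x * ∑ a, grad φ x a * hodge (grad g) x a ∂area = rotPairing k φ g := by
  have hprod := (HasGrad.of_smooth (smooth_X k)).mul (.of_smooth hφ)
  have hsplit : ∀ x, ∑ a, grad (fun y => X k y * φ y) x a * hodge (grad g) x a
      = X k x * ∑ a, grad φ x a * hodge (grad g) x a - φ x * rotDeriv k g x := fun x => by
    have hX := sum_grad_X_mul_hodge_grad (g := g) k x
    simp only [hprod.grad_eq, add_mul, Finset.sum_add_distrib, mul_assoc, ← Finset.mul_sum]
    linear_combination φ x * hX
  have hzero := integral_grad_mul_hodge_grad ((smooth_X k).mul hφ) hg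
  have := (IsOneForm.grad hg).hodge.smooth
  have := smooth_X k
  simp only [hsplit] at hzero
  rw [integral_sub (SmoothOnSphere.integrable (by fun_prop))
    (hφ.mul (smooth_rotDeriv k hg)).integrable] at hzero
  exact sub_eq_zero.1 hzero

theorem integral_mul_inner2_hess (hT : IsSTF T) (hφ : SmoothOnSphere φ) (hf : SmoothOnSphere f) :
    ∫ x, φ x * inner2 (T x) (hess f x) ∂area = -∫ x, φ x * ∑ b, grad f x b * div2 T x b ∂area
      - ∫ x, ∑ a, contract T (grad f) x a * grad φ x a ∂area := by
  have hdiv := (isOneForm_div2 hT.smooth).smooth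
  have hess := smooth_inner2 hT.smooth (isTensor_hess hf).smooth
  rw [integral_sum_mul_grad hφ (hT.isTensor.contract hf.grad), sub_neg_eq_add,
    eq_neg_add_iff_add_eq, ← integral_add (SmoothOnSphere.integrable (by fun_prop))
    (hφ.mul hess).integrable]
  refine integral_congr_ae <| .of_forall fun x => ?_
  simp only [div1_contract hT.isTensor (.grad hf) x, ← mul_add, inner2_comm (T x)]
  rfl

theorem integral_grad_X_mul_contract_grad (hT : IsSTF T) (hφ : SmoothOnSphere φ) :
    ∫ x, ∑ a, grad (X k) x a * contract T (grad φ) x a ∂area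
      = -∫ x, φ x * ∑ b, grad (X k) x b * div2 T x b ∂area := by
  have hsymm : ∀ x, ∑ a, grad (X k) x a * contract T (grad φ) x a
      = ∑ a, contract T (grad (X k)) x a * grad φ x a := fun x => by
    simp only [contract, Finset.mul_sum, Finset.sum_mul]
    rw [Finset.sum_comm]
    refine Finset.sum_congr rfl fun a _ => Finset.sum_congr rfl fun b _ => ?_
    rw [hT.symm x b a]
    ring
  have htrace : ∀ x, inner2 (covDeriv1 (grad (X k)) x) (T x) = 0 := fun x => by
    have hσ : ∀ a, ∑ b, sigma x a b * T x a b = T x a a := fun a =>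
      sum_sigma_mul_of_tangent x a (hT.tangent x a)
    simp only [inner2, covDeriv1_grad_X, mul_assoc, ← Finset.mul_sum, hσ, hT.traceless, mul_zero]
  simp only [hsymm]
  rw [integral_sum_mul_grad hφ (hT.isTensor.contract (isOneForm_grad_X k).smooth)]
  simp only [div1_contract hT.isTensor (isOneForm_grad_X k), htrace, add_zero]

theorem sum_mul_div2_shearTensor (hf : IsModeTwo f) (hg : IsModeTwo g) (V : Fin 3 → ℝ) (x : S2) :
    ∑ b, V b * div2 (shearTensor f g) x b
      = -2 * ∑ b, V b * grad f x b - 2 * ∑ b, V b * hodge (grad g) x b := by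
  simp only [div2_shearTensor x _ hf hg, Finset.mul_sum, ← Finset.sum_sub_distrib]
  exact Finset.sum_congr rfl fun b _ => by ring

theorem integral_grad_mul_div2_shearTensor (hφ : SmoothOnSphere φ) (hf : IsModeTwo f)
    (hg : IsModeTwo g) :
    ∫ x, ∑ b, grad φ x b * div2 (shearTensor f g) x b ∂area = -12 * ∫ x, φ x * f x ∂area := by
  have := hφ.grad
  have := hf.smooth.grad
  have := (IsOneForm.grad hg.smooth).hodge.smooth
  simp only [sum_mul_div2_shearTensor hf hg]
  rw [integral_sub (SmoothOnSphere.integrable (by fun_prop))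
    (SmoothOnSphere.integrable (by fun_prop)), integral_const_mul, integral_const_mul,
    hf.integral_grad_mul_grad hφ, integral_grad_mul_hodge_grad hφ hg.smooth]
  ring

theorem integral_mul_div1_div2_shearTensor (hφ : SmoothOnSphere φ) (hf : IsModeTwo f)
    (hg : IsModeTwo g) :
    ∫ x, φ x * div1 (div2 (shearTensor f g)) x ∂area = 12 * ∫ x, φ x * f x ∂area := by
  have h := integral_sum_mul_grad hφ
    (isOneForm_div2 (isSTF_shearTensor hf.smooth hg.smooth).smooth)
  simp only [mul_comm (div2 _ _ _), integral_grad_mul_div2_shearTensor hφ hf hg] at h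
  linarith

theorem integral_inner2_hess (hφ : SmoothOnSphere φ) (hf : IsModeTwo f) (hg : IsModeTwo g) :
    ∫ x, inner2 (shearTensor f g x) (hess φ x) ∂area = 12 * ∫ x, φ x * f x ∂area := by
  have h := integral_sum_mul_div2 (.grad hφ) (isSTF_shearTensor hf.smooth hg.smooth).isTensor
  simp only [integral_grad_mul_div2_shearTensor hφ hf hg, inner2_comm (covDeriv1 _ _)] at h
  exact (neg_injective (by linarith!))

theorem integral_inner2_shearTensor (hf : IsModeTwo f) (hg : IsModeTwo g) (hf' : IsModeTwo f')
    (hg' : IsModeTwo g') :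
    ∫ x, inner2 (shearTensor f g x) (shearTensor f' g' x) ∂area
      = 12 * ∫ x, (f x * f' x + g x * g' x) ∂area := by
  have hC := isSTF_shearTensor hf.smooth hg.smooth
  simp only [inner2_shearTensor _ hC hg'.smooth]
  rw [integral_sub (smooth_inner2 hC.smooth (isTensor_hess hf'.smooth).smooth).integrable
    (smooth_inner2 hC.dual.smooth (isTensor_hess hg'.smooth).smooth).integrable,
    dual_shearTensor hf.smooth hg.smooth, integral_inner2_hess hf'.smooth hf hg,
    integral_inner2_hess hg'.smooth hg.neg hf,
    integral_add (hf.smooth.mul hf'.smooth).integrable (hg.smooth.mul hg'.smooth).integrable]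
  simp only [Pi.neg_apply, mul_neg, integral_neg, mul_comm (f' _), mul_comm (g' _), neg_mul]
  ring

theorem integral_grad_X_mul_contract_shearTensor (hφ : SmoothOnSphere φ) (hφe : Function.Even φ)
    (hf : IsModeTwo f) (hg : IsModeTwo g) :
    ∫ x, ∑ a, grad (X k) x a * contract (shearTensor f g) (grad φ) x a ∂area
      = -2 * rotPairing k φ g := by
  have hsplit : ∀ x, φ x * ∑ b, grad (X k) x b * div2 (shearTensor f g) x b
      = -2 * (φ x * ∑ b, grad (X k) x b * grad f x b) + 2 * (φ x * rotDeriv k g x) := fun x => by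
    rw [sum_mul_div2_shearTensor hf hg, sum_grad_X_mul_hodge_grad]
    ring
  have := hf.smooth.grad
  have := (isOneForm_grad_X k).smooth
  rw [integral_grad_X_mul_contract_grad k (isSTF_shearTensor hf.smooth hg.smooth) hφ]
  simp only [hsplit]
  rw [integral_add (SmoothOnSphere.integrable (by fun_prop))
    ((hφ.mul (smooth_rotDeriv k hg.smooth)).integrable.const_mul 2), integral_const_mul,
    integral_const_mul, integral_mul_grad_X_mul_grad_eq_zero k hφe hf.even hf.smooth]
  simp only [rotPairing]
  ring

theorem contract_div2_shearTensor (hT : IsSTF T) (hf : IsModeTwo f) (hg : IsModeTwo g) (x : S2)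
    (a : Fin 3) : contract T (div2 (shearTensor f g)) x a
      = 2 * contract (dual T) (grad g) x a - 2 * contract T (grad f) x a := by
  have hhodge := contract_hodge (V := grad g) x a hT
  simp only [contract] at hhodge ⊢
  rw [sum_mul_div2_shearTensor hf hg, hhodge]
  ring

theorem integral_grad_X_mul_contract_div2 (hf : IsModeTwo f) (hg : IsModeTwo g)
    (hf' : IsModeTwo f') (hg' : IsModeTwo g') :
    ∫ x, ∑ a, grad (X k) x a * contract (shearTensor f g) (div2 (shearTensor f' g')) x a ∂area
      = 4 * rotPairing k f' g - 4 * rotPairing k g' f := by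
  have hC := isSTF_shearTensor hf.smooth hg.smooth
  have := (isOneForm_grad_X k).smooth
  have := (hC.isTensor.contract hf'.smooth.grad).smooth
  have := (hC.dual.isTensor.contract hg'.smooth.grad).smooth
  simp only [contract_div2_shearTensor hC hf' hg', mul_sub, Finset.sum_sub_distrib,
    mul_left_comm _ (2 : ℝ), ← Finset.mul_sum]
  rw [integral_sub (SmoothOnSphere.integrable (by fun_prop))
    (SmoothOnSphere.integrable (by fun_prop)), integral_const_mul, integral_const_mul,
    dual_shearTensor hf.smooth hg.smooth,
    integral_grad_X_mul_contract_shearTensor k hf'.smooth hf'.even hf hg,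
    integral_grad_X_mul_contract_shearTensor k hg'.smooth hg'.even hg.neg hf]
  ring

theorem integral_rotation_mul_contract_div2 (hf : IsModeTwo f) (hg : IsModeTwo g)
    (hf' : IsModeTwo f') (hg' : IsModeTwo g') :
    ∫ x, ∑ a, rotation k x a * contract (shearTensor f g) (div2 (shearTensor f' g')) x a ∂area
      = 4 * rotPairing k f f' + 4 * rotPairing k g g' := by
  have h : ∀ x, ∑ a, rotation k x a * contract (shearTensor f g) (div2 (shearTensor f' g')) x a
      = -∑ a, grad (X k) x a * contract (dual (shearTensor f g)) (div2 (shearTensor f' g')) x a :=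
    fun x => sum_hodge_mul_contract x
  simp only [h, integral_neg, dual_shearTensor hf.smooth hg.smooth]
  rw [integral_grad_X_mul_contract_div2 k hg.neg hf hf' hg', rotPairing_neg_right k hg.smooth,
    rotPairing_antisymm k hf.smooth hf'.smooth, rotPairing_antisymm k hg.smooth hg'.smooth]
  ring

theorem integral_X_mul_inner2_hess (hφ : SmoothOnSphere φ) (hφe : Function.Even φ)
    (hf : IsModeTwo f) (hg : IsModeTwo g) :
    ∫ x, X k x * inner2 (shearTensor f g x) (hess φ x) ∂area = 4 * rotPairing k φ g := by
  have hcontract : ∫ x, ∑ a, contract (shearTensor f g) (grad φ) x a * grad (X k) x a ∂area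
      = -2 * rotPairing k φ g := by
    simp only [mul_comm (contract _ _ _ _)]
    exact integral_grad_X_mul_contract_shearTensor k hφ hφe hf hg
  have hsplit : ∀ x, X k x * ∑ b, grad φ x b * div2 (shearTensor f g) x b
      = -2 * (X k x * ∑ b, grad φ x b * grad f x b)
        - 2 * (X k x * ∑ b, grad φ x b * hodge (grad g) x b) := fun x => by
    rw [sum_mul_div2_shearTensor hf hg]
    ring
  have := hφ.grad
  have := hf.smooth.grad
  have := (IsOneForm.grad hg.smooth).hodge.smooth
  have := smooth_X k
  rw [integral_mul_inner2_hess (isSTF_shearTensor hf.smooth hg.smooth) (smooth_X k) hφ, hcontract]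
  simp only [hsplit]
  rw [integral_sub (SmoothOnSphere.integrable (by fun_prop))
    (SmoothOnSphere.integrable (by fun_prop)), integral_const_mul, integral_const_mul,
    integral_X_mul_grad_mul_grad_eq_zero k hφe hf.even,
    integral_X_mul_grad_mul_hodge_grad k hφ hg.smooth]
  ring

theorem integral_X_mul_inner2_shearTensor (hf : IsModeTwo f) (hg : IsModeTwo g)
    (hf' : IsModeTwo f') (hg' : IsModeTwo g') :
    ∫ x, X k x * inner2 (shearTensor f g x) (shearTensor f' g' x) ∂area
      = 4 * rotPairing k f' g - 4 * rotPairing k g' f := by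
  have hC := isSTF_shearTensor hf.smooth hg.smooth
  have hX := smooth_X k
  simp only [inner2_shearTensor _ hC hg'.smooth, mul_sub]
  rw [integral_sub (hX.mul (smooth_inner2 hC.smooth (isTensor_hess hf'.smooth).smooth)).integrable
    (hX.mul (smooth_inner2 hC.dual.smooth (isTensor_hess hg'.smooth).smooth)).integrable,
    dual_shearTensor hf.smooth hg.smooth, integral_X_mul_inner2_hess k hf'.smooth hf'.even hf hg,
    integral_X_mul_inner2_hess k hg'.smooth hg'.even hg.neg hf]

end Pairings

section CubicIntegrals

variable {f g h : S2 → ℝ} {S T : S2 → Fin 3 → Fin 3 → ℝ}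

theorem hasGrad_sq (hf : SmoothOnSphere f) :
    HasGrad (fun x => f x * f x) (fun x a => 2 * (f x * grad f x a)) :=
  ((HasGrad.of_smooth hf).mul (.of_smooth hf)).congr fun x a => by ring

theorem hasGrad_normSq_grad (hf : SmoothOnSphere f) :
    HasGrad (fun x => ∑ b, grad f x b * grad f x b)
      (fun x a => 2 * ∑ b, hess f x a b * grad f x b) := by
  refine (HasGrad.sum _ fun b _ => hasGrad_sq (hf.grad b)).congr fun x a => ?_
  have hproj := sum_mul_sum_sigma_mul x ((IsOneForm.grad hf).tangent x)
    fun b => partialDeriv a (fun y => grad f y b) x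
  simp only [← Finset.mul_sum, mul_comm (hess f x a _)]
  exact congrArg (2 * ·) hproj.symm

theorem IsModeTwo.contract_closedPart (hf : IsModeTwo f) (x : S2) (a : Fin 3) :
    contract (closedPart f) (grad f) x a
      = 1 / 2 * grad (fun x => ∑ b, grad f x b * grad f x b) x a
        + 3 / 2 * grad (fun x => f x * f x) x a := by
  have hsplit : ∀ b, closedPart f x a b * grad f x b
      = hess f x a b * grad f x b + 3 * f x * (sigma x a b * grad f x b) := fun b => by
    rw [closedPart, hf.laplacian_eq]
    ring
  simp only [contract, hsplit, Finset.sum_add_distrib, ← Finset.mul_sum,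
    sum_sigma_mul_of_tangent x a ((IsOneForm.grad hf.smooth).tangent x),
    (hasGrad_normSq_grad hf.smooth).grad_eq, (hasGrad_sq hf.smooth).grad_eq]
  ring

theorem IsModeTwo.integral_mul_normSq_grad (hh : IsModeTwo h) (hf : IsModeTwo f) :
    ∫ x, h x * ∑ a, grad f x a * grad f x a ∂area = 3 * ∫ x, h x * (f x * f x) ∂area := by
  have := hf.smooth
  have := hh.smooth
  have := hf.smooth.grad
  have := hh.smooth.grad
  have hsq := hh.integral_grad_mul_grad (hf.smooth.mul hf.smooth)
  have hprod := hf.integral_grad_mul_grad (hh.smooth.mul hf.smooth)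
  have hgrad := ((HasGrad.of_smooth hh.smooth).mul (.of_smooth hf.smooth)).grad_eq
  simp only [hgrad, (hasGrad_sq hf.smooth).grad_eq, add_mul, Finset.sum_add_distrib, mul_assoc,
    ← Finset.mul_sum] at hsq hprod
  rw [integral_const_mul] at hsq
  rw [integral_add (SmoothOnSphere.integrable (by fun_prop))
    (SmoothOnSphere.integrable (by fun_prop))] at hprod
  have hcomm : ∀ x, ∑ a, grad h x a * grad f x a = ∑ a, grad f x a * grad h x a := fun x =>
    Finset.sum_congr rfl fun a _ => mul_comm _ _
  simp only [hcomm, mul_comm _ (h _), mul_left_comm _ (h _)] at hsq hprod ⊢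
  linarith

/-- Since `K ∇f = ½ ∇|∇f|² + 3/2 ∇f²` for `K = closedPart f`, integration by parts leaves only
multiples of `∫ h f²`. -/
theorem IsModeTwo.integral_mul_inner2_closedPart (hh : IsModeTwo h) (hf : IsModeTwo f) :
    ∫ x, h x * inner2 (closedPart f x) (closedPart f x) ∂area
      = -12 * ∫ x, h x * (f x * f x) ∂area := by
  have hK := isSTF_closedPart hf.smooth
  have hsq := (hasGrad_sq hf.smooth).smooth
  have hnorm := (hasGrad_normSq_grad hf.smooth).smooth
  have := hsq.grad
  have := hnorm.grad
  have := hh.smooth.grad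
  have hdiv : ∀ x, h x * ∑ b, grad f x b * div2 (closedPart f) x b
      = -2 * (h x * ∑ b, grad f x b * grad f x b) := fun x => by
    simp only [hf.div2_closedPart, mul_left_comm _ (-2 : ℝ), ← Finset.mul_sum]
  have hcontract : ∫ x, ∑ a, contract (closedPart f) (grad f) x a * grad h x a ∂area
      = 1 / 2 * (6 * ∫ x, (∑ b, grad f x b * grad f x b) * h x ∂area)
        + 3 / 2 * (6 * ∫ x, f x * f x * h x ∂area) := by
    rw [← hh.integral_grad_mul_grad hsq, ← hh.integral_grad_mul_grad hnorm]
    simp only [hf.contract_closedPart, add_mul, Finset.sum_add_distrib, mul_assoc,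
      ← Finset.mul_sum]
    rw [integral_add (SmoothOnSphere.integrable (by fun_prop))
      (SmoothOnSphere.integrable (by fun_prop)), integral_const_mul, integral_const_mul]
  simp only [hK.inner2_closedPart]
  rw [integral_mul_inner2_hess hK hh.smooth hf.smooth, hcontract]
  simp only [hdiv, mul_comm _ (h _), integral_const_mul, hh.integral_mul_normSq_grad hf]
  ring

theorem inner2_shearTensor_self (x : S2) (hg : SmoothOnSphere g) :
    inner2 (shearTensor f g x) (shearTensor f g x)
      = inner2 (closedPart f x) (closedPart f x) + inner2 (closedPart g x) (closedPart g x)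
        + 2 * inner2 (closedPart f x) (dual (closedPart g) x) := by
  rw [← inner2_dual_dual (S := closedPart g) x (isSTF_closedPart hg), shearTensor_eq hg]
  simp only [inner2, Finset.mul_sum, ← Finset.sum_add_distrib]
  exact Finset.sum_congr rfl fun a _ => Finset.sum_congr rfl fun b _ => by ring

theorem integral_mul_inner2_shearTensor_self (hh : IsModeTwo h) (hf : IsModeTwo f)
    (hg : IsModeTwo g) :
    ∫ x, h x * inner2 (shearTensor f g x) (shearTensor f g x) ∂area
      = -12 * ∫ x, h x * (f x * f x + g x * g x) ∂area := by
  have hF := isSTF_closedPart hf.smooth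
  have hG := isSTF_closedPart hg.smooth
  have hodd : ∫ x, h x * (2 * inner2 (closedPart f x) (dual (closedPart g) x)) ∂area = 0 :=
    integral_toSphere_eq_zero_of_odd fun x => by
      simp only [inner2, dual, closedPart_neg_of_even _ _ _ hf.even hf.smooth,
        closedPart_neg_of_even _ _ _ hg.even hg.smooth, epsilon_neg, hh.even x, neg_mul, mul_neg,
        Finset.sum_neg_distrib]
  have hFF := hh.smooth.mul (smooth_inner2 hF.smooth hF.smooth)
  have hGG := hh.smooth.mul (smooth_inner2 hG.smooth hG.smooth)
  have hFG := hh.smooth.mul (.mul (.const 2) (smooth_inner2 hF.smooth hG.dual.smooth))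
  simp only [inner2_shearTensor_self _ hg.smooth, mul_add]
  rw [integral_add (hFF.add hGG).integrable hFG.integrable, hodd, add_zero,
    integral_add hFF.integrable hGG.integrable, hh.integral_mul_inner2_closedPart hf,
    hh.integral_mul_inner2_closedPart hg,
    integral_add (hh.smooth.mul (hf.smooth.mul hf.smooth)).integrable
      (hh.smooth.mul (hg.smooth.mul hg.smooth)).integrable]
  ring

end CubicIntegrals

/-! ### Quadratic forms on the sphere -/

/-- The coefficients of an `ℓ = 2` harmonic: a symmetric traceless matrix. -/
structure IsQuadrupole (A : Matrix (Fin 3) (Fin 3) ℝ) : Prop where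
  isSymm : A.IsSymm
  trace_eq_zero : A.trace = 0

section Quadrupoles

open Matrix
variable {A B D : Matrix (Fin 3) (Fin 3) ℝ} (M N : Matrix (Fin 3) (Fin 3) ℝ) (k a : Fin 3) (x : S2)

theorem quadForm_eq : quadForm M x = (X · x) ⬝ᵥ M *ᵥ (X · x) := by
  simp only [quadForm, dotProduct, mulVec, Finset.mul_sum]
  exact Finset.sum_congr rfl fun i _ => Finset.sum_congr rfl fun j _ => by ring

theorem quadForm_add : quadForm (M + N) x = quadForm M x + quadForm N x := by
  simp only [quadForm_eq, add_mulVec, dotProduct_add]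

theorem quadForm_smul (r : ℝ) : quadForm (r • M) x = r * quadForm M x := by
  simp only [quadForm_eq, smul_mulVec, dotProduct_smul, smul_eq_mul]

theorem quadForm_transpose : quadForm Mᵀ x = quadForm M x := by
  rw [quadForm_eq, quadForm_eq, dotProduct_comm, mulVec_transpose, dotProduct_mulVec]

theorem quadForm_neg_apply : quadForm M (-x) = quadForm M x := by
  simp only [quadForm, X_neg, mul_neg, neg_mul, neg_neg]

theorem hasGrad_mulVec_X (i : Fin 3) : HasGrad (fun x => (M *ᵥ (X · x)) i)
    (fun x a => M i a - X a x * (M *ᵥ (X · x)) i) :=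
  (HasGrad.sum Finset.univ fun j _ => (HasGrad.coord j).const_mul (M i j)).congr fun x a => by
    simp only [mul_comm (M i _), sum_sigma_mul x a (M i), mulVec, dotProduct]

theorem hasGrad_quadForm : HasGrad (quadForm M)
    (fun x a => ((M + Mᵀ) *ᵥ (X · x)) a - 2 * quadForm M x * X a x) := by
  have h := (HasGrad.sum Finset.univ fun i _ => (HasGrad.coord i).mul (hasGrad_mulVec_X M i))
  simp only [funext (quadForm_eq M)]
  refine h.congr fun x a => ?_
  have hMt : ∑ i, X i x * M i a = (Mᵀ *ᵥ (X · x)) a :=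
    Finset.sum_congr rfl fun i _ => mul_comm _ _
  simp only [mul_comm _ (sigma x a _), mul_sub, Finset.sum_add_distrib, Finset.sum_sub_distrib,
    hMt, sum_sigma_mul, mul_left_comm _ (X a x), ← Finset.mul_sum, add_mulVec, Pi.add_apply,
    dotProduct]
  ring

theorem smooth_quadForm : SmoothOnSphere (quadForm M) := (hasGrad_quadForm M).smooth

theorem sum_X_mul_add_transpose_mulVec :
    ∑ a, X a x * ((M + Mᵀ) *ᵥ (X · x)) a = 2 * quadForm M x := by
  refine (quadForm_eq (M + Mᵀ) x).symm.trans ?_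
  rw [quadForm_add, quadForm_transpose, two_mul]

theorem laplacian_quadForm : laplacian (quadForm M) x = 2 * M.trace - 6 * quadForm M x := by
  have h := fun a => (hasGrad_mulVec_X (M + Mᵀ) a).sub
    (((hasGrad_quadForm M).const_mul 2).mul (.coord a))
  have htrace : ∑ a, (M + Mᵀ) a a = 2 * M.trace := by
    rw [two_mul]; nth_rw 2 [← trace_transpose]; exact trace_add _ _
  calc laplacian (quadForm M) x = div1 (grad (quadForm M)) x := rfl
    _ = ∑ a, ((M + Mᵀ) a a - 3 * (X a x * ((M + Mᵀ) *ᵥ (X · x)) a)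
          - 2 * quadForm M x * sigma x a a + 4 * quadForm M x * (X a x * X a x)) := by
      rw [(hasGrad_quadForm M).grad_eq, div1_eq fun a => (h a).smooth]
      exact Finset.sum_congr rfl fun a _ => ((h a).eq a x).trans (by ring)
    _ = 2 * M.trace - 6 * quadForm M x := by
      simp only [Finset.sum_add_distrib, Finset.sum_sub_distrib, ← Finset.mul_sum, htrace,
        sum_X_mul_add_transpose_mulVec, sum_sigma_self, sum_X_mul_X]
      ring

theorem IsQuadrupole.isModeTwo_quadForm (hA : IsQuadrupole A) : IsModeTwo (quadForm A) where
  smooth := smooth_quadForm A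
  laplacian_eq x := by rw [laplacian_quadForm, hA.trace_eq_zero]; ring
  even := quadForm_neg_apply A

theorem sum_grad_quadForm_mul_grad_quadForm :
    ∑ a, grad (quadForm M) x a * grad (quadForm N) x a
      = quadForm ((M + Mᵀ) * (N + Nᵀ)) x - 4 * quadForm M x * quadForm N x := by
  have hsymm : (M + Mᵀ)ᵀ = M + Mᵀ := by rw [transpose_add, transpose_transpose, add_comm]
  have hcross : quadForm ((M + Mᵀ) * (N + Nᵀ)) x
      = ∑ a, ((M + Mᵀ) *ᵥ (X · x)) a * ((N + Nᵀ) *ᵥ (X · x)) a := by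
    rw [quadForm_eq, ← mulVec_mulVec, dotProduct_mulVec, ← mulVec_transpose, hsymm, dotProduct]
  calc ∑ a, grad (quadForm M) x a * grad (quadForm N) x a
      = ∑ a, (((M + Mᵀ) *ᵥ (X · x)) a * ((N + Nᵀ) *ᵥ (X · x)) a
          - 2 * quadForm M x * (X a x * ((N + Nᵀ) *ᵥ (X · x)) a)
          - 2 * quadForm N x * (X a x * ((M + Mᵀ) *ᵥ (X · x)) a)
          + 4 * quadForm M x * quadForm N x * (X a x * X a x)) := by
        rw [(hasGrad_quadForm M).grad_eq, (hasGrad_quadForm N).grad_eq]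
        exact Finset.sum_congr rfl fun a _ => by ring
    _ = quadForm ((M + Mᵀ) * (N + Nᵀ)) x - 4 * quadForm M x * quadForm N x := by
        simp only [Finset.sum_add_distrib, Finset.sum_sub_distrib, ← Finset.mul_sum, hcross,
          sum_X_mul_add_transpose_mulVec, sum_X_mul_X]
        ring

theorem integral_X_mul_X (i j : Fin 3) :
    ∫ x, X i x * X j x ∂area = 4 * Real.pi / 3 * delta i j := by
  have hint : Integrable (fun x => X i x * X j x) area :=
    ((smooth_X i).mul (smooth_X j)).integrable
  have h := integral_partialDeriv (smooth_X j) i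
  simp only [(HasGrad.coord j).eq, sigma] at h
  rw [integral_sub (integrable_const _) hint, integral_const_area] at h
  linarith

theorem integral_quadForm : ∫ x, quadForm M x ∂area = 4 * Real.pi / 3 * M.trace := by
  have hint : ∀ i j, Integrable (fun x => M i j * (X i x * X j x)) area := fun i j =>
    ((smooth_X i).mul (smooth_X j)).integrable.const_mul _
  simp only [quadForm, mul_assoc]
  rw [integral_finsetSum _ fun i _ => integrable_finsetSum _ fun j _ => hint i j]
  simp only [integral_finsetSum _ fun j _ => hint _ j, integral_const_mul, integral_X_mul_X,
    delta, mul_ite, mul_one, mul_zero, Finset.sum_ite_eq, Finset.mem_univ, if_true,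
    ← Finset.sum_mul, trace, diag_apply]
  ring

theorem IsQuadrupole.integral_quadForm_mul (hA : IsQuadrupole A) :
    ∫ x, quadForm A x * quadForm M x ∂area = 8 * Real.pi / 15 * (A * M).trace := by
  have hgrad := hA.isModeTwo_quadForm.integral_grad_mul_grad (smooth_quadForm M)
  have htrace : ((M + Mᵀ) * (A + Aᵀ)).trace = 4 * (A * M).trace := by
    have hAt : (Mᵀ * A).trace = (A * M).trace := by
      rw [← trace_transpose, transpose_mul, transpose_transpose, hA.isSymm]
    rw [hA.isSymm, ← two_smul ℝ A, mul_smul_comm, trace_smul, add_mul, trace_add, hAt,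
      trace_mul_comm M]
    simp only [smul_eq_mul]
    ring
  simp only [sum_grad_quadForm_mul_grad_quadForm, mul_assoc, mul_comm (quadForm M _)] at hgrad
  rw [integral_sub (smooth_quadForm _).integrable
    (((smooth_quadForm A).mul (smooth_quadForm M)).integrable.const_mul _), integral_const_mul,
    integral_quadForm, htrace] at hgrad
  linarith

theorem IsQuadrupole.integral_quadForm_mul_sq (hD : IsQuadrupole D) (hA : IsQuadrupole A) :
    ∫ x, quadForm D x * (quadForm A x * quadForm A x) ∂area
      = 32 * Real.pi / 105 * (D * (A * A)).trace := by
  have hgrad := hD.isModeTwo_quadForm.integral_mul_normSq_grad hA.isModeTwo_quadForm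
  have hsq : ∀ x, quadForm D x * ∑ a, grad (quadForm A) x a * grad (quadForm A) x a
      = 4 * (quadForm D x * quadForm (A * A) x)
        - 4 * (quadForm D x * (quadForm A x * quadForm A x)) := fun x => by
    rw [sum_grad_quadForm_mul_grad_quadForm, hA.isSymm, ← two_smul ℝ A, smul_mul_smul_comm,
      quadForm_smul]
    ring
  have hD' := smooth_quadForm D
  have hA' := smooth_quadForm A
  simp only [hsq] at hgrad
  rw [integral_sub ((hD'.mul (smooth_quadForm _)).integrable.const_mul _)
    ((hD'.mul (hA'.mul hA')).integrable.const_mul _), integral_const_mul, integral_const_mul,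
    hD.integral_quadForm_mul] at hgrad
  linarith

/-- The infinitesimal rotation about the `k`-th axis. -/
def rotationMatrix (k : Fin 3) : Matrix (Fin 3) (Fin 3) ℝ := fun i j => leviCivita i k j

theorem rotDeriv_quadForm (hA : A.IsSymm) :
    rotDeriv k (quadForm A) x = 2 * quadForm (A * rotationMatrix k) x := by
  have hrot : ∀ a, rotation k x a = (rotationMatrix k *ᵥ (X · x)) a := fun a => by
    rw [NullInfinityData.rotation, (HasGrad.coord k).grad_eq, sum_epsilon_mul_sigma]
    rfl
  calc rotDeriv k (quadForm A) x
      = ∑ a, (2 * ((A *ᵥ (X · x)) a * rotation k x a)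
          - 2 * quadForm A x * (rotation k x a * X a x)) := by
        rw [rotDeriv, (hasGrad_quadForm A).grad_eq, hA]
        exact Finset.sum_congr rfl fun a _ => by simp only [add_mulVec, Pi.add_apply]; ring
    _ = 2 * quadForm (A * rotationMatrix k) x := by
        rw [Finset.sum_sub_distrib, ← Finset.mul_sum, ← Finset.mul_sum,
          (isOneForm_rotation k).tangent, mul_zero, sub_zero, quadForm_eq, ← mulVec_mulVec,
          dotProduct_mulVec, ← mulVec_transpose, hA]
        simp only [hrot, dotProduct]

theorem epsContract_eq_trace : epsContract M N k = (M * N * rotationMatrix k).trace := by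
  simp only [epsContract, trace, diag_apply, mul_apply, rotationMatrix, Finset.sum_mul]
  refine Finset.sum_congr rfl fun i _ => Finset.sum_comm.trans ?_
  refine Finset.sum_congr rfl fun p _ => Finset.sum_congr rfl fun j _ => ?_
  rw [show leviCivita p k i = leviCivita i p k by unfold leviCivita; ring]

theorem IsQuadrupole.rotPairing_quadForm (hB : IsQuadrupole B) (hA : A.IsSymm) :
    rotPairing k (quadForm B) (quadForm A) = 16 * Real.pi / 15 * epsContract B A k := by
  simp only [rotPairing, rotDeriv_quadForm k _ hA, mul_left_comm _ (2 : ℝ)]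
  rw [integral_const_mul, hB.integral_quadForm_mul, epsContract_eq_trace, Matrix.mul_assoc]
  ring

end Quadrupoles

section DerivativesOfIntegrals

/-! ### Differentiation under the integral sign -/

open Filter Topology

theorem hasDerivWithinAt_integral_of_lipschitz {α E : Type*} [MeasurableSpace α]
    [NormedAddCommGroup E] [NormedSpace ℝ E] {μ : Measure α} {s : Set ℝ} {u : ℝ}
    {F : ℝ → α → E} {F' : α → E} {bound : α → ℝ} (hu : u ∈ s)
    (hF : ∀ᶠ t in 𝓝[s] u, Integrable (F t) μ)
    (hlip : ∀ᶠ t in 𝓝[s] u, ∀ᵐ a ∂μ, ‖F t a - F u a‖ ≤ bound a * ‖t - u‖)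
    (hbound : Integrable bound μ)
    (hderiv : ∀ᵐ a ∂μ, HasDerivWithinAt (fun t => F t a) (F' a) s u) :
    HasDerivWithinAt (fun t => ∫ a, F t a ∂μ) (∫ a, F' a ∂μ) s u := by
  have hFu : Integrable (F u) μ := hF.self_of_nhdsWithin hu
  have hle : 𝓝[s \ {u}] u ≤ 𝓝[s] u := nhdsWithin_mono u sdiff_subset
  rw [hasDerivWithinAt_iff_tendsto_slope]
  have hint : ∀ᶠ t in 𝓝[s \ {u}] u,
      ∫ a, slope (fun t => F t a) u t ∂μ = slope (fun t => ∫ a, F t a ∂μ) u t := by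
    filter_upwards [hle hF] with t ht
    simp only [slope, vsub_eq_sub]
    rw [integral_smul, integral_sub ht hFu]
  refine Tendsto.congr' hint (tendsto_integral_filter_of_dominated_convergence bound ?_ ?_ hbound
    (hderiv.mono fun a ha => hasDerivWithinAt_iff_tendsto_slope.1 ha))
  · filter_upwards [hle hF] with t ht
    exact ((ht.sub hFu).smul (t - u)⁻¹).aestronglyMeasurable
  · filter_upwards [hle hlip, self_mem_nhdsWithin] with t ht htu
    filter_upwards [ht] with a ha
    have hpos : 0 < ‖t - u‖ := norm_pos_iff.2 (sub_ne_zero.2 htu.2)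
    rw [slope, vsub_eq_sub, norm_smul, norm_inv, inv_mul_le_iff₀ hpos, mul_comm]
    exact ha

theorem uniqueDiffOn_of_ordConnected {I : Set ℝ} (hI : I.OrdConnected) (hI' : I.Nontrivial) :
    UniqueDiffOn ℝ I :=
  uniqueDiffOn_convex hI.convex (hI.convex.nontrivial_iff_nonempty_interior.1 hI')

variable {I : Set ℝ}

theorem JointlySmooth.smooth {f : ℝ → S2 → ℝ} (hf : JointlySmooth I f) {u : ℝ} (hu : u ∈ I) :
    SmoothOnSphere (f u) :=
  ContDiffOn.comp (g := fun p : ℝ × E3 => radialExt (f p.1) p.2) hf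
    (f := fun y : E3 => (u, y)) (by fun_prop) fun _ hy => ⟨hu, hy⟩

theorem JointlySmooth.apply {f : ℝ → S2 → Fin 3 → ℝ} (hf : JointlySmooth I f) (a : Fin 3) :
    JointlySmooth I fun t x => f t x a := by
  refine (contDiffOn_pi.1 hf a).congr fun p _ => ?_
  by_cases hp : p.2 = 0 <;> simp [radialExt, hp]

theorem JointlySmooth.exists_continuous_deriv (hI : UniqueDiffOn ℝ I) {f : ℝ → S2 → ℝ}
    (hf : JointlySmooth I f) :
    ∃ f' : ℝ → S2 → ℝ, Continuous (fun p : I × S2 => f' p.1 p.2) ∧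
      ∀ t ∈ I, ∀ x, HasDerivWithinAt (fun t => f t x) (f' t x) I t := by
  have hu : UniqueDiffOn ℝ (I ×ˢ ({0}ᶜ : Set E3)) :=
    hI.prod isOpen_compl_singleton.uniqueDiffOn
  refine ⟨fun t x => fderivWithin ℝ (fun p : ℝ × E3 => radialExt (f p.1) p.2)
    (I ×ˢ ({0}ᶜ : Set E3)) (t, (x : E3)) (1, 0), ?_, fun t ht x => ?_⟩
  · exact ((hf.continuousOn_fderivWithin hu (by simp)).comp_continuous
      (f := fun p : I × S2 => ((p.1 : ℝ), (p.2 : E3))) (by fun_prop)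
      fun p => mk_mem_prod p.1.2 (coe_mem_compl_zero p.2)).clm_apply continuous_const
  · have hf' := (hf.differentiableOn (by simp) (t, (x : E3))
      ⟨ht, coe_mem_compl_zero x⟩).hasFDerivWithinAt.comp_hasDerivWithinAt t
      ((hasDerivWithinAt_id t I).prodMk (hasDerivWithinAt_const t I (x : E3)))
      fun s hs => mk_mem_prod hs (coe_mem_compl_zero x)
    exact hf'.congr (fun s _ => (radialExt_coe x (f s)).symm) (radialExt_coe x (f t)).symm

theorem JointlySmooth.continuous_of_hasDerivWithinAt (hI : UniqueDiffOn ℝ I) {f : ℝ → S2 → ℝ}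
    (hf : JointlySmooth I f) {u : ℝ} (hu : u ∈ I) {f' : S2 → ℝ}
    (hd : ∀ x, HasDerivWithinAt (fun t => f t x) (f' x) I u) : Continuous f' := by
  obtain ⟨g, hgc, hgd⟩ := hf.exists_continuous_deriv hI
  have hf' : f' = g u := funext fun x => (hI u hu).eq_deriv _ (hd x) (hgd u hu x)
  exact hf' ▸ hgc.comp (f := fun x : S2 => ((⟨u, hu⟩ : I), x)) (by fun_prop)

theorem JointlySmooth.exists_eventually_norm_sub_le (hI : I.OrdConnected) (hI' : I.Nontrivial)
    {f : ℝ → S2 → ℝ} (hf : JointlySmooth I f) {u : ℝ} (hu : u ∈ I) :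
    ∃ K, ∀ᶠ t in 𝓝[I] u, ∀ x, ‖f t x - f u x‖ ≤ K * ‖t - u‖ := by
  obtain ⟨f', hfc, hfd⟩ := hf.exists_continuous_deriv (uniqueDiffOn_of_ordConnected hI hI')
  have hfu : Continuous (f' u) := hfc.comp (f := fun x : S2 => ((⟨u, hu⟩ : I), x)) (by fun_prop)
  obtain ⟨K, hK⟩ := isCompact_univ.exists_bound_of_continuousOn hfu.continuousOn
  have hnear : ∀ᶠ t : I in 𝓝 ⟨u, hu⟩, ∀ x ∈ (univ : Set S2), ‖f' t x‖ < K + 1 :=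
    isCompact_univ.eventually_forall_of_forall_eventually fun x hx =>
      hfc.norm.continuousAt.eventually
        (gt_mem_nhds ((hK x hx).trans_lt (lt_add_one K) : ‖f' u x‖ < K + 1))
  rw [nhds_subtype_eq_comap, eventually_comap] at hnear
  obtain ⟨ε, hε, hball⟩ := Metric.eventually_nhds_iff_ball.1 hnear
  refine ⟨K + 1, ?_⟩
  filter_upwards [inter_mem_nhdsWithin I (Metric.ball_mem_nhds u hε)] with t ht x
  exact (hI.convex.inter (convex_ball u ε)).norm_image_sub_le_of_norm_hasDerivWithin_le
    (fun s hs => (hfd s hs.1 x).mono inter_subset_left)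
    (fun s hs => (hball s hs.2 ⟨s, hs.1⟩ rfl x (mem_univ x)).le)
    ⟨hu, Metric.mem_ball_self hε⟩ ht

theorem JointlySmooth.hasDerivWithinAt_integral_mul (hI : I.OrdConnected) (hI' : I.Nontrivial)
    {f : ℝ → S2 → ℝ} (hf : JointlySmooth I f) {φ : S2 → ℝ} (hφ : Continuous φ) {u : ℝ}
    (hu : u ∈ I) {f' : S2 → ℝ} (hd : ∀ x, HasDerivWithinAt (fun t => f t x) (f' x) I u) :
    HasDerivWithinAt (fun t => ∫ x, φ x * f t x ∂area) (∫ x, φ x * f' x ∂area) I u := by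
  obtain ⟨K, hK⟩ := hf.exists_eventually_norm_sub_le hI hI' hu
  refine hasDerivWithinAt_integral_of_lipschitz (bound := fun x => ‖φ x‖ * K) hu ?_ ?_
    (integrable_of_continuous (by fun_prop)) (.of_forall fun x => (hd x).const_mul (φ x))
  · filter_upwards [self_mem_nhdsWithin] with t ht
    exact integrable_of_continuous (hφ.mul (hf.smooth ht).continuous)
  · filter_upwards [hK] with t ht
    refine .of_forall fun x => ?_
    rw [← mul_sub, norm_mul, mul_assoc]
    exact mul_le_mul_of_nonneg_left (ht x) (norm_nonneg _)

theorem JointlySmooth.hasDerivWithinAt_integral_sum_mul (hI : I.OrdConnected)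
    (hI' : I.Nontrivial) {w : ℝ → S2 → Fin 3 → ℝ} (hw : JointlySmooth I w) {V : S2 → Fin 3 → ℝ}
    (hV : ∀ a, Continuous fun x => V x a) {u : ℝ} (hu : u ∈ I) {w' : S2 → Fin 3 → ℝ}
    (hd : ∀ x a, HasDerivWithinAt (fun t => w t x a) (w' x a) I u) :
    HasDerivWithinAt (fun t => ∫ x, ∑ a, V x a * w t x a ∂area)
      (∫ x, ∑ a, V x a * w' x a ∂area) I u := by
  have hw' (a) : Continuous fun x => w' x a := (hw.apply a).continuous_of_hasDerivWithinAt
    (uniqueDiffOn_of_ordConnected hI hI') hu fun x => hd x a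
  have hsum {W : S2 → Fin 3 → ℝ} (hW : ∀ a, Continuous fun x => W x a) :
      ∫ x, ∑ a, V x a * W x a ∂area = ∑ a, ∫ x, V x a * W x a ∂area :=
    integral_finsetSum _ fun a _ => integrable_of_continuous ((hV a).mul (hW a))
  rw [hsum hw']
  exact (HasDerivWithinAt.fun_sum fun a _ => (hw.apply a).hasDerivWithinAt_integral_mul hI hI'
    (hV a) hu fun x => hd x a).congr_of_mem
    (fun t ht => hsum fun a => ((hw.apply a).smooth ht).continuous) hu

end DerivativesOfIntegrals

/-! ### Quadrupole moments depending on retarded time -/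

section QuadrupoleMoments

open Matrix

variable {A B : Matrix (Fin 3) (Fin 3) ℝ}

theorem hess_sum_mul {ι : Type*} (s : Finset ι) (r : ι → ℝ) {g : ι → S2 → ℝ}
    (hg : ∀ i ∈ s, SmoothOnSphere (g i)) (x : S2) (a b : Fin 3) :
    hess (fun y => ∑ i ∈ s, r i * g i y) x a b = ∑ i ∈ s, r i * hess (g i) x a b := by
  have hgrad : grad (fun y => ∑ i ∈ s, r i * g i y) = fun y d => ∑ i ∈ s, r i * grad (g i) y d :=
    (HasGrad.sum s fun i hi => (HasGrad.of_smooth (hg i hi)).const_mul (r i)).grad_eq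
  have hpartial (d : Fin 3) : partialDeriv a (fun y => ∑ i ∈ s, r i * grad (g i) y d) x
      = ∑ i ∈ s, r i * partialDeriv a (fun y => grad (g i) y d) x :=
    (HasGrad.sum s fun i hi => (HasGrad.of_smooth ((hg i hi).grad d)).const_mul (r i)).eq a x
  simp only [hess, covDeriv1, hgrad, hpartial, Finset.mul_sum]
  rw [Finset.sum_comm]
  simp only [mul_left_comm]

theorem sqNorm_eq_trace (hA : A.IsSymm) : sqNorm A = (A * A).trace := by
  simp only [sqNorm, trace, Matrix.diag_apply, mul_apply, hA.apply, sq]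

theorem rotationMatrix_transpose (k : Fin 3) : (rotationMatrix k)ᵀ = -rotationMatrix k := by
  ext i j
  simp only [rotationMatrix, leviCivita, transpose_apply, Matrix.neg_apply]
  ring

theorem epsContract_antisymm (hA : A.IsSymm) (hB : B.IsSymm) (k : Fin 3) :
    epsContract A B k = -epsContract B A k := by
  rw [epsContract_eq_trace, epsContract_eq_trace, ← trace_transpose, transpose_mul, transpose_mul,
    rotationMatrix_transpose, hA.eq, hB.eq, neg_mul, trace_neg, trace_mul_comm]

theorem isHarmonicOfMode_quadForm (hA : A.trace = 0) : IsHarmonicOfMode 2 (quadForm A) :=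
  ⟨smooth_quadForm A, fun x => by rw [laplacian_quadForm, hA]; norm_num⟩

theorem isHarmonicOfMode_rotDeriv_quadForm (hA : A.IsSymm) (k : Fin 3) :
    IsHarmonicOfMode 2 (rotDeriv k (quadForm A)) := by
  have htrace : (A * rotationMatrix k).trace = 0 := by
    have h : (A * rotationMatrix k).trace = -(A * rotationMatrix k).trace :=
      (trace_transpose _).symm.trans <| by
        rw [transpose_mul, rotationMatrix_transpose, hA.eq, neg_mul, trace_neg, trace_mul_comm]
    linarith
  have hrot : rotDeriv k (quadForm A) = quadForm ((2 : ℝ) • (A * rotationMatrix k)) :=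
    funext fun x => (rotDeriv_quadForm k x hA).trans (quadForm_smul _ x 2).symm
  rw [hrot]
  exact isHarmonicOfMode_quadForm (by rw [trace_smul, htrace, smul_zero])

/-- The symmetric traceless matrix `T` for which `tr (A T) = A k l` whenever `A` is symmetric and
traceless; it reads off the components of an `ℓ = 2` mode. -/
def traceFreeUnit (k l : Fin 3) : Matrix (Fin 3) (Fin 3) ℝ :=
  (1 / 2 : ℝ) • (single k l 1 + single l k 1) - (1 / 3 * delta k l) • 1

theorem isQuadrupole_traceFreeUnit (k l : Fin 3) : IsQuadrupole (traceFreeUnit k l) where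
  isSymm := by
    simp only [IsSymm, traceFreeUnit, transpose_sub, transpose_smul, transpose_add,
      transpose_single, transpose_one, add_comm]
  trace_eq_zero := by
    fin_cases k <;> fin_cases l <;> simp [traceFreeUnit, delta, trace_add] <;> norm_num

theorem trace_traceFreeUnit_mul (hA : A.IsSymm) (k l : Fin 3) :
    (traceFreeUnit k l * A).trace = A k l - 1 / 3 * delta k l * A.trace := by
  simp only [traceFreeUnit, sub_mul, smul_mul, add_mul, one_mul, trace_sub, trace_smul, trace_add,
    trace_single_mul, hA.apply k l, smul_eq_mul]
  ring

theorem massModeRate_eq (hA : A.IsSymm) (hB : B.IsSymm) (k l : Fin 3) :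
    massModeRate A B k l = 6 / 7 * (traceFreeUnit k l * (A * A + B * B)).trace := by
  have hsymm : (A * A + B * B).IsSymm := by
    simp only [IsSymm, transpose_add, transpose_mul, hA.eq, hB.eq]
  rw [trace_traceFreeUnit_mul hsymm, trace_add, massModeRate, sqNorm_eq_trace hA,
    sqNorm_eq_trace hB]
  simp only [Matrix.add_apply, mul_apply, Finset.sum_add_distrib, hA.apply, hB.apply]

variable {I : Set ℝ} {u : ℝ} {c d : ℝ → Matrix (Fin 3) (Fin 3) ℝ}

theorem hasDerivWithinAt_hess_quadForm
    (hc : ∀ i j, HasDerivWithinAt (fun t => c t i j) (A i j) I u) (x : S2) (a b : Fin 3) :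
    HasDerivWithinAt (fun t => hess (quadForm (c t)) x a b) (hess (quadForm A) x a b) I u := by
  have hess_eq_sum (M : Matrix (Fin 3) (Fin 3) ℝ) : hess (quadForm M) x a b
      = ∑ p : Fin 3 × Fin 3, M p.1 p.2 * hess (fun y => X p.1 y * X p.2 y) x a b := by
    rw [← hess_sum_mul _ _ fun p _ => (smooth_X p.1).mul (smooth_X p.2)]
    simp only [funext fun y => quadForm.eq_def M y, Fintype.sum_prod_type, mul_assoc]
  simp only [hess_eq_sum]
  exact HasDerivWithinAt.fun_sum fun p _ => (hc p.1 p.2).mul_const _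

theorem hasDerivWithinAt_shearTensor_quadForm
    (hc : ∀ i j, HasDerivWithinAt (fun t => c t i j) (A i j) I u)
    (hd : ∀ i j, HasDerivWithinAt (fun t => d t i j) (B i j) I u) (x : S2) (a b : Fin 3) :
    HasDerivWithinAt (fun t => shearTensor (quadForm (c t)) (quadForm (d t)) x a b)
      (shearTensor (quadForm A) (quadForm B) x a b) I u := by
  have hessc := hasDerivWithinAt_hess_quadForm hc x
  have hessd := hasDerivWithinAt_hess_quadForm hd x
  exact ((hessc a b).sub ((HasDerivWithinAt.fun_sum fun e _ => hessc e e).const_mul _)).add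
    ((HasDerivWithinAt.fun_sum fun e _ =>
      ((hessd e b).const_mul _).add ((hessd e a).const_mul _)).const_mul _)

theorem hasDerivWithinAt_epsContract
    (hc : ∀ i j, HasDerivWithinAt (fun t => c t i j) (A i j) I u)
    (hd : ∀ i j, HasDerivWithinAt (fun t => d t i j) (B i j) I u) (k : Fin 3) :
    HasDerivWithinAt (fun t => epsContract (c t) (d t) k)
      (epsContract A (d u) k + epsContract (c u) B k) I u := by
  have h : HasDerivWithinAt (fun t => epsContract (c t) (d t) k) _ I u :=
    HasDerivWithinAt.fun_sum fun i _ => HasDerivWithinAt.fun_sum fun j _ =>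
      HasDerivWithinAt.fun_sum fun p _ => ((hc i j).mul (hd j p)).mul_const (leviCivita i p k)
  refine h.congr_deriv ?_
  simp only [epsContract, ← Finset.sum_add_distrib, add_mul]

theorem IsQuadrupole.of_hasDerivWithinAt (hI : UniqueDiffWithinAt ℝ I u) (hu : u ∈ I)
    (hc : ∀ t ∈ I, IsQuadrupole (c t))
    (hA : ∀ i j, HasDerivWithinAt (fun t => c t i j) (A i j) I u) : IsQuadrupole A where
  isSymm := IsSymm.ext fun i j => hI.eq_deriv I (hA j i)
    ((hA i j).congr_of_mem (fun t ht => (hc t ht).isSymm.apply i j) hu)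
  trace_eq_zero := hI.eq_deriv I (HasDerivWithinAt.fun_sum fun i _ => hA i i)
    ((hasDerivWithinAt_const u I (0 : ℝ)).congr_of_mem (fun t ht => (hc t ht).trace_eq_zero) hu)

end QuadrupoleMoments

/-! ### Data with quadrupole shear -/

section Potentials

variable {f g φ : S2 → ℝ} (k : Fin 3)

theorem integral_grad_X_mul_smul_grad (hf : SmoothOnSphere f) (hφ : SmoothOnSphere φ) :
    ∫ x, ∑ a, grad (X k) x a * (f x * grad φ x a) ∂area
      = 2 * ∫ x, X k x * (f x * φ x) ∂area - ∫ x, φ x * grad f x k ∂area := by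
  have hV := isOneForm_grad_X k
  have hdiv (x : S2) : φ x * div1 (fun y a => f y * grad (X k) y a) x
      = φ x * grad f x k - 2 * (X k x * (f x * φ x)) := by
    rw [div1_smul hf hV.smooth, div1_grad_X, sum_grad_X_mul k x ((IsOneForm.grad hf).tangent x)]
    ring
  have hswap (x : S2) : ∑ a, grad (X k) x a * (f x * grad φ x a)
      = ∑ a, f x * grad (X k) x a * grad φ x a :=
    Finset.sum_congr rfl fun a _ => by ring
  simp only [hswap]
  rw [integral_sum_mul_grad hφ (.smul hf hV)]
  simp only [hdiv]
  rw [integral_sub (hφ.mul (hf.grad k)).integrable (SmoothOnSphere.integrable (by fun_prop)),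
    integral_const_mul]
  ring

theorem integral_rotation_mul_smul_grad (f φ : S2 → ℝ) :
    ∫ x, ∑ a, rotation k x a * (f x * grad φ x a) ∂area = rotPairing k f φ := by
  simp only [rotPairing, rotDeriv, Finset.mul_sum, mul_left_comm]

theorem integral_grad_X_mul_smul_hodge_grad (f φ : S2 → ℝ) :
    ∫ x, ∑ a, grad (X k) x a * (f x * hodge (grad φ) x a) ∂area = -rotPairing k f φ := by
  simp only [mul_left_comm _ (f _), ← Finset.mul_sum, sum_grad_X_mul_hodge_grad, mul_neg,
    integral_neg, rotPairing]

theorem IsModeTwo.div2_coclosedPart (hg : IsModeTwo g) (x : S2) (b : Fin 3) :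
    div2 (coclosedPart g) x b = -2 * hodge (grad g) x b := by
  rw [coclosedPart_eq_dual hg.smooth, div2_dual x b (isSTF_closedPart hg.smooth)]
  simp only [hodge, hg.div2_closedPart, Finset.mul_sum, mul_left_comm]

theorem IsModeTwo.integral_X_mul_normSq_div2_coclosedPart (hg : IsModeTwo g) :
    ∫ x, X k x * ∑ b, div2 (coclosedPart g) x b * div2 (coclosedPart g) x b ∂area = 0 :=
  integral_toSphere_eq_zero_of_odd fun x => by
    simp only [hg.div2_coclosedPart, hodge, X_neg, epsilon_neg, grad_neg_of_even x _ hg.even,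
      neg_mul, mul_neg, neg_neg]

end Potentials

section Integrals

theorem integral_sum_mul_sub {V F G : S2 → Fin 3 → ℝ} (hV : ∀ a, SmoothOnSphere fun x => V x a)
    (hF : ∀ a, SmoothOnSphere fun x => F x a) (hG : ∀ a, SmoothOnSphere fun x => G x a) :
    ∫ x, ∑ a, V x a * (F x a - G x a) ∂area
      = (∫ x, ∑ a, V x a * F x a ∂area) - ∫ x, ∑ a, V x a * G x a ∂area := by
  rw [← integral_sub (SmoothOnSphere.integrable (by fun_prop))
    (SmoothOnSphere.integrable (by fun_prop))]
  simp only [← Finset.sum_sub_distrib, mul_sub]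

theorem integral_sum_mul_const_mul (V F : S2 → Fin 3 → ℝ) (r : ℝ) :
    ∫ x, ∑ a, V x a * (r * F x a) ∂area = r * ∫ x, ∑ a, V x a * F x a ∂area := by
  rw [← integral_const_mul]
  simp only [Finset.mul_sum, mul_left_comm r]

end Integrals

namespace NullInfinityData

variable {I : Set ℝ} (D : NullInfinityData I) {u : ℝ}

theorem smooth_mass (hu : u ∈ I) : SmoothOnSphere (D.m u) := D.smooth_m.smooth hu

theorem momentum_eq (k : Fin 3) (u : ℝ) : D.momentum k u = 2 * ∫ x, X k x * D.m u x ∂area := by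
  rw [momentum, ← integral_const_mul]
  exact integral_congr_ae <| .of_forall fun x => by ring

theorem sum_mul_momentum (hu : u ∈ I) (v : Fin 3 → ℝ) :
    ∑ j, v j * D.momentum j u = 2 * ∫ x, D.m u x * ∑ j, v j * X j x ∂area := by
  have hm := D.smooth_mass hu
  simp only [Finset.mul_sum]
  rw [integral_finsetSum _ fun j _ => SmoothOnSphere.integrable (by fun_prop), Finset.mul_sum]
  refine Finset.sum_congr rfl fun j _ => ?_
  simp only [momentum_eq, mul_left_comm (D.m u _), integral_const_mul, mul_comm (D.m u _)]
  ring

theorem hasDerivWithinAt_integral_aspect (hI : I.OrdConnected) (hI' : I.Nontrivial) (hu : u ∈ I)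
    {V : S2 → Fin 3 → ℝ} (hV : IsOneForm V) :
    HasDerivWithinAt (fun t => ∫ x, ∑ a, V x a * D.aspect t x a ∂area)
      (∫ x, ∑ a, V x a * aspectRate (D.m u) (D.shear u) (D.news u) x a ∂area) I u :=
  D.smooth_aspect.hasDerivWithinAt_integral_sum_mul hI hI' (fun a => (hV.smooth a).continuous) hu
    (D.evol_aspect u hu)

section Charges

variable (hu : u ∈ I) (hC : IsSTF (D.shear u)) {f g : ℝ → S2 → ℝ} (k : Fin 3)

include hC in
theorem smooth_shearDiv (a : Fin 3) : SmoothOnSphere fun x => D.shearDiv u x a :=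
  (hC.isTensor.contract (isOneForm_div2 hC.smooth).smooth).smooth a

include hu hC in
theorem smooth_centerForm (a : Fin 3) : SmoothOnSphere fun x => D.centerForm u x a := by
  have haspect := (D.smooth_aspect.apply a).smooth hu
  have hm := (D.smooth_mass hu).grad a
  have hdiv := D.smooth_shearDiv hC a
  have hnorm := (smooth_inner2 hC.smooth hC.smooth).grad a
  unfold centerForm
  fun_prop

include hu hC

theorem classicalAngularMomentum_eq :
    D.classicalAngularMomentum k u = ∫ x, ∑ a, rotation k x a * D.aspect u x a ∂area
      - 1 / 4 * ∫ x, ∑ a, rotation k x a * contract (D.shear u) (div2 (D.shear u)) x a ∂area := by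
  have haspect (a) := (D.smooth_aspect.apply a).smooth hu
  have hdiv := D.smooth_shearDiv hC
  rw [classicalAngularMomentum, integral_sum_mul_sub (isOneForm_rotation k).smooth haspect
    (by fun_prop), integral_sum_mul_const_mul]
  rfl

theorem classicalCenterOfMass_eq :
    D.classicalCenterOfMass k u = ∫ x, ∑ a, grad (X k) x a * D.aspect u x a ∂area
      - u * D.momentum k u
      - 1 / 4 * ∫ x, ∑ a, grad (X k) x a * contract (D.shear u) (div2 (D.shear u)) x a ∂area
      - 1 / 8 * ∫ x, X k x * inner2 (D.shear u x) (D.shear u x) ∂area := by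
  have hV := (isOneForm_grad_X k).smooth
  have hnorm := smooth_inner2 hC.smooth hC.smooth
  have haspect (a) := (D.smooth_aspect.apply a).smooth hu
  have hm := (D.smooth_mass hu).grad
  have hdiv := D.smooth_shearDiv hC
  simp only [classicalCenterOfMass, centerForm]
  rw [integral_sum_mul_sub hV (by fun_prop) (by fun_prop),
    integral_sum_mul_sub hV (by fun_prop) (by fun_prop),
    integral_sum_mul_sub hV haspect (by fun_prop), integral_sum_mul_const_mul,
    integral_sum_mul_const_mul, integral_sum_mul_const_mul,
    integral_grad_X_mul_grad k (D.smooth_mass hu), integral_grad_X_mul_grad k hnorm, momentum_eq]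
  simp only [shearDiv, contract]
  ring

theorem cwyAngularMomentum_eq (hf : SmoothOnSphere (f u)) :
    D.cwyAngularMomentum f k u
      = D.classicalAngularMomentum k u - rotPairing k (f u) (D.m u) := by
  have haspect (a) := (D.smooth_aspect.apply a).smooth hu
  have hm := (D.smooth_mass hu).grad
  have hdiv := D.smooth_shearDiv hC
  rw [cwyAngularMomentum, integral_sum_mul_sub (isOneForm_rotation k).smooth (by fun_prop)
    (by fun_prop), integral_rotation_mul_smul_grad]
  rfl

theorem cwyCenterOfMass_eq (hg : SmoothOnSphere (g u)) :
    D.cwyCenterOfMass g k u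
      = D.classicalCenterOfMass k u + 2 * rotPairing k (g u) (D.m u) := by
  have hm := (IsOneForm.hodge (.grad (D.smooth_mass hu))).smooth
  have hsplit : D.cwyCenterOfMass g k u = ∫ x, ∑ a, grad (X k) x a
      * (D.centerForm u x a - 2 * (g u x * hodge (grad (D.m u)) x a)) ∂area := by
    simp only [cwyCenterOfMass, hodge, mul_assoc]
  rw [hsplit, integral_sum_mul_sub (isOneForm_grad_X k).smooth (D.smooth_centerForm hu hC)
    (by fun_prop), integral_sum_mul_const_mul, integral_grad_X_mul_smul_hodge_grad,
    classicalCenterOfMass]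
  ring

theorem cwyCenterOfMassGeneral_eq (hf : SmoothOnSphere (f u)) (hg : IsModeTwo (g u)) :
    D.cwyCenterOfMassGeneral f g k u
      = D.cwyCenterOfMass g k u + ∫ x, D.m u x * grad (f u) x k ∂area
        + ∫ x, X k x * (f u x * D.m u x) ∂area := by
  have hm := D.smooth_mass hu
  have hhodge := (IsOneForm.hodge (.grad hg.smooth)).smooth
  have hcenter := D.smooth_centerForm hu hC
  have hV := (isOneForm_grad_X k).smooth
  have hdiv : SmoothOnSphere fun x => ∑ b, div2 (coclosedPart (g u)) x b
      * div2 (coclosedPart (g u)) x b := by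
    simp only [hg.div2_coclosedPart]
    fun_prop
  have hmain (x : S2) (a : Fin 3) : D.centerForm u x a - f u x * grad (D.m u) x a
        + 2 * (∑ b, epsilon x a b * grad (g u) x b) * D.m u x
      = D.centerForm u x a - f u x * grad (D.m u) x a
        - -2 * (D.m u x * hodge (grad (g u)) x a) := by
    rw [hodge]
    ring
  have hquad (x : S2) : 3 * X k x * f u x * D.m u x - 1 / 4 * X k x
        * ∑ b, div2 (coclosedPart (g u)) x b * div2 (coclosedPart (g u)) x b
      = 3 * (X k x * (f u x * D.m u x)) - 1 / 4 * (X k x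
        * ∑ b, div2 (coclosedPart (g u)) x b * div2 (coclosedPart (g u)) x b) := by
    ring
  simp only [cwyCenterOfMassGeneral, hmain, hquad]
  rw [integral_sum_mul_sub hV (by fun_prop) (by fun_prop), integral_sum_mul_sub hV hcenter
    (by fun_prop), integral_sum_mul_const_mul, integral_grad_X_mul_smul_hodge_grad,
    integral_grad_X_mul_smul_grad k hf hm, integral_sub (SmoothOnSphere.integrable (by fun_prop))
    (SmoothOnSphere.integrable (by fun_prop)), integral_const_mul, integral_const_mul,
    hg.integral_X_mul_normSq_div2_coclosedPart, D.cwyCenterOfMass_eq hu hC k hg.smooth,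
    rotPairing_antisymm k hm hg.smooth, classicalCenterOfMass]
  ring

end Charges

end NullInfinityData

/-- Null infinity data on a nondegenerate interval whose shear has the mode-two potentials
`∑ c_{ij} X^i X^j` and `∑ c̲_{ij} X^i X^j`, with `n = ∂_u c` and `n̲ = ∂_u c̲`. -/
structure HasQuadrupoleShear {I : Set ℝ} (D : NullInfinityData I)
    (c cb n nb : ℝ → Matrix (Fin 3) (Fin 3) ℝ) : Prop where
  ordConnected : I.OrdConnected
  nontrivial : I.Nontrivial
  quad_c : ∀ u ∈ I, IsQuadrupole (c u)
  quad_cb : ∀ u ∈ I, IsQuadrupole (cb u)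
  deriv_c : ∀ u ∈ I, ∀ i j, HasDerivWithinAt (fun t => c t i j) (n u i j) I u
  deriv_cb : ∀ u ∈ I, ∀ i j, HasDerivWithinAt (fun t => cb t i j) (nb u i j) I u
  shear_eq : ∀ u ∈ I, D.shear u = shearTensor (quadForm (c u)) (quadForm (cb u))

namespace HasQuadrupoleShear

theorem mk_of_potentials {I : Set ℝ} {D : NullInfinityData I}
    {c cb n nb : ℝ → Matrix (Fin 3) (Fin 3) ℝ} (hI : I.OrdConnected) (hI' : I.Nontrivial)
    (hc : ∀ u ∈ I, (c u).IsSymm ∧ (c u).trace = 0)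
    (hcb : ∀ u ∈ I, (cb u).IsSymm ∧ (cb u).trace = 0)
    (hC : ∀ u ∈ I, ∀ x a b, D.shear u x a b =
      closedPart (quadForm (c u)) x a b + coclosedPart (quadForm (cb u)) x a b)
    (hn : ∀ u ∈ I, ∀ i j, HasDerivWithinAt (fun t => c t i j) (n u i j) I u)
    (hnb : ∀ u ∈ I, ∀ i j, HasDerivWithinAt (fun t => cb t i j) (nb u i j) I u) :
    HasQuadrupoleShear D c cb n nb where
  ordConnected := hI
  nontrivial := hI'
  quad_c u hu := ⟨(hc u hu).1, (hc u hu).2⟩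
  quad_cb u hu := ⟨(hcb u hu).1, (hcb u hu).2⟩
  deriv_c := hn
  deriv_cb := hnb
  shear_eq u hu := funext fun x => funext fun a => funext fun b => hC u hu x a b

variable {I : Set ℝ} {D : NullInfinityData I} {c cb n nb mh : ℝ → Matrix (Fin 3) (Fin 3) ℝ}
  {u : ℝ} (h : HasQuadrupoleShear D c cb n nb) (hu : u ∈ I)
  (hmh : ∀ t ∈ I, IsModeTwoPart (D.modifiedMass t) (mh t)) (k : Fin 3)
include h hu

theorem uniqueDiffWithinAt : UniqueDiffWithinAt ℝ I u :=
  uniqueDiffOn_of_ordConnected h.ordConnected h.nontrivial u hu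

theorem quad_n : IsQuadrupole (n u) :=
  .of_hasDerivWithinAt (h.uniqueDiffWithinAt hu) hu h.quad_c (h.deriv_c u hu)

theorem quad_nb : IsQuadrupole (nb u) :=
  .of_hasDerivWithinAt (h.uniqueDiffWithinAt hu) hu h.quad_cb (h.deriv_cb u hu)

theorem news_eq : D.news u = shearTensor (quadForm (n u)) (quadForm (nb u)) := by
  ext x a b
  refine (h.uniqueDiffWithinAt hu).eq_deriv I (D.news_eq u hu x a b)
    ((hasDerivWithinAt_shearTensor_quadForm (h.deriv_c u hu) (h.deriv_cb u hu) x a b).congr_of_mem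
      (fun t ht => ?_) hu)
  rw [h.shear_eq t ht]

theorem isSTF_shear : IsSTF (D.shear u) :=
  h.shear_eq u hu ▸ isSTF_shearTensor (smooth_quadForm _) (smooth_quadForm _)

theorem isSTF_news : IsSTF (D.news u) :=
  h.news_eq hu ▸ isSTF_shearTensor (smooth_quadForm _) (smooth_quadForm _)

theorem hasDerivWithinAt_integral_mul_m {φ : S2 → ℝ} (hφ : SmoothOnSphere φ) :
    HasDerivWithinAt (fun t => ∫ x, φ x * D.m t x ∂area)
      (-(1 / 8) * ∫ x, φ x * inner2 (D.news u x) (D.news u x) ∂area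
        + 3 * ∫ x, φ x * quadForm (n u) x ∂area) I u := by
  have hN := h.isSTF_news hu
  have hnorm := smooth_inner2 hN.smooth hN.smooth
  have hdiv : SmoothOnSphere (div1 (div2 (D.news u))) :=
    .div1 (isOneForm_div2 hN.smooth).smooth
  refine (D.smooth_m.hasDerivWithinAt_integral_mul h.ordConnected h.nontrivial hφ.continuous hu
    (D.evol_m u hu)).congr_deriv ?_
  have hsplit (x : S2) : φ x * (-(1 / 8) * inner2 (D.news u x) (D.news u x)
        + 1 / 4 * div1 (div2 (D.news u)) x)
      = -(1 / 8) * (φ x * inner2 (D.news u x) (D.news u x))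
        + 1 / 4 * (φ x * div1 (div2 (D.news u)) x) := by
    ring
  simp only [hsplit]
  rw [integral_add (SmoothOnSphere.integrable (by fun_prop))
    (SmoothOnSphere.integrable (by fun_prop)), integral_const_mul, integral_const_mul,
    h.news_eq hu, integral_mul_div1_div2_shearTensor hφ (h.quad_n hu).isModeTwo_quadForm
    (h.quad_nb hu).isModeTwo_quadForm]
  ring

theorem hasDerivWithinAt_energy : HasDerivWithinAt D.energy
    (-(8 * Real.pi / 5) * (sqNorm (n u) + sqNorm (nb u))) I u := by
  have hn := h.quad_n hu
  have hnb := h.quad_nb hu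
  have hq := smooth_quadForm
  refine (h.hasDerivWithinAt_integral_mul_m hu (.const 2)).congr_deriv ?_
  rw [integral_const_mul, integral_const_mul, integral_quadForm, hn.trace_eq_zero, h.news_eq hu,
    integral_inner2_shearTensor hn.isModeTwo_quadForm hnb.isModeTwo_quadForm
      hn.isModeTwo_quadForm hnb.isModeTwo_quadForm,
    integral_add (SmoothOnSphere.integrable (by fun_prop))
      (SmoothOnSphere.integrable (by fun_prop)),
    hn.integral_quadForm_mul, hnb.integral_quadForm_mul, ← sqNorm_eq_trace hn.isSymm,
    ← sqNorm_eq_trace hnb.isSymm]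
  ring

theorem hasDerivWithinAt_momentum : HasDerivWithinAt (D.momentum k)
    (-(32 * Real.pi / 15) * epsContract (n u) (nb u) k) I u := by
  have hn := h.quad_n hu
  have hnb := h.quad_nb hu
  have hodd : ∫ x, X k x * quadForm (n u) x ∂area = 0 :=
    integral_toSphere_eq_zero_of_odd fun x => by rw [X_neg, quadForm_neg_apply, neg_mul]
  have hmass := (h.hasDerivWithinAt_integral_mul_m hu (smooth_X k)).const_mul 2
  rw [hodd, h.news_eq hu, integral_X_mul_inner2_shearTensor k hn.isModeTwo_quadForm
    hnb.isModeTwo_quadForm hn.isModeTwo_quadForm hnb.isModeTwo_quadForm,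
    rotPairing_antisymm k (smooth_quadForm (nb u)) (smooth_quadForm (n u)),
    hn.rotPairing_quadForm k hnb.isSymm] at hmass
  rw [funext (D.momentum_eq k)]
  exact hmass.congr_deriv (by ring)

theorem classicalAngularMomentum_eq : D.classicalAngularMomentum k u
    = ∫ x, ∑ a, rotation k x a * D.aspect u x a ∂area := by
  have hc := (h.quad_c u hu).isModeTwo_quadForm
  have hcb := (h.quad_cb u hu).isModeTwo_quadForm
  rw [D.classicalAngularMomentum_eq hu (h.isSTF_shear hu), h.shear_eq u hu,
    integral_rotation_mul_contract_div2 k hc hcb hc hcb]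
  linear_combination -(1 / 2) * rotPairing_antisymm k hc.smooth hc.smooth
    - 1 / 2 * rotPairing_antisymm k hcb.smooth hcb.smooth

theorem classicalCenterOfMass_eq : D.classicalCenterOfMass k u
    = ∫ x, ∑ a, grad (X k) x a * D.aspect u x a ∂area - u * D.momentum k u
      - 16 * Real.pi / 5 * epsContract (c u) (cb u) k := by
  have hc := (h.quad_c u hu).isModeTwo_quadForm
  have hcb := (h.quad_cb u hu).isModeTwo_quadForm
  rw [D.classicalCenterOfMass_eq hu (h.isSTF_shear hu), h.shear_eq u hu,
    integral_grad_X_mul_contract_div2 k hc hcb hc hcb,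
    integral_X_mul_inner2_shearTensor k hc hcb hc hcb,
    rotPairing_antisymm k hcb.smooth hc.smooth,
    (h.quad_c u hu).rotPairing_quadForm k (h.quad_cb u hu).isSymm]
  ring

theorem hasDerivWithinAt_classicalAngularMomentum :
    HasDerivWithinAt (D.classicalAngularMomentum k)
      (16 * Real.pi / 5 * (epsContract (c u) (n u) k + epsContract (cb u) (nb u) k)) I u := by
  have hc := h.quad_c u hu
  have hcb := h.quad_cb u hu
  have hn := h.quad_n hu
  have hnb := h.quad_nb hu
  refine ((D.hasDerivWithinAt_integral_aspect h.ordConnected h.nontrivial hu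
    (isOneForm_rotation k)).congr_of_mem
      (fun t ht => h.classicalAngularMomentum_eq ht k) hu).congr_deriv ?_
  rw [integral_rotation_mul_aspectRate k (D.smooth_mass hu) (h.isSTF_shear hu) (h.isSTF_news hu),
    h.shear_eq u hu, h.news_eq hu, dual_shearTensor (smooth_quadForm _) (smooth_quadForm _),
    integral_X_mul_inner2_shearTensor k hcb.isModeTwo_quadForm.neg hc.isModeTwo_quadForm
      hn.isModeTwo_quadForm hnb.isModeTwo_quadForm,
    integral_rotation_mul_contract_div2 k hc.isModeTwo_quadForm hcb.isModeTwo_quadForm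
      hn.isModeTwo_quadForm hnb.isModeTwo_quadForm,
    rotPairing_neg_right k (smooth_quadForm _), rotPairing_antisymm k (smooth_quadForm (n u))
      (smooth_quadForm (c u)), rotPairing_antisymm k (smooth_quadForm (nb u))
      (smooth_quadForm (cb u)), hc.rotPairing_quadForm k hn.isSymm,
    hcb.rotPairing_quadForm k hnb.isSymm]
  ring

theorem hasDerivWithinAt_classicalCenterOfMass :
    HasDerivWithinAt (D.classicalCenterOfMass k)
      (32 * u * Real.pi / 15 * epsContract (n u) (nb u) k) I u := by
  have hc := h.quad_c u hu
  have hcb := h.quad_cb u hu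
  have hn := h.quad_n hu
  have hnb := h.quad_nb hu
  have haspect := D.hasDerivWithinAt_integral_aspect h.ordConnected h.nontrivial hu
    (isOneForm_grad_X k)
  refine (((haspect.sub ((hasDerivWithinAt_id u I).mul (h.hasDerivWithinAt_momentum hu k))).sub
    ((hasDerivWithinAt_epsContract (h.deriv_c u hu) (h.deriv_cb u hu) k).const_mul
      (16 * Real.pi / 5))).congr_of_mem
        (fun t ht => h.classicalCenterOfMass_eq ht k) hu).congr_deriv ?_
  rw [integral_grad_X_mul_aspectRate k (D.smooth_mass hu) (h.isSTF_shear hu) (h.isSTF_news hu),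
    h.shear_eq u hu, h.news_eq hu,
    integral_X_mul_inner2_shearTensor k hc.isModeTwo_quadForm hcb.isModeTwo_quadForm
      hn.isModeTwo_quadForm hnb.isModeTwo_quadForm,
    integral_grad_X_mul_contract_div2 k hc.isModeTwo_quadForm hcb.isModeTwo_quadForm
      hn.isModeTwo_quadForm hnb.isModeTwo_quadForm, D.momentum_eq, id,
    rotPairing_antisymm k (smooth_quadForm (nb u)) (smooth_quadForm (c u)),
    hn.rotPairing_quadForm k hcb.isSymm, hc.rotPairing_quadForm k hnb.isSymm]
  ring

theorem cwyCenterOfMassGeneral_eq :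
    D.cwyCenterOfMassGeneral (fun t => quadForm (c t)) (fun t => quadForm (cb t)) k u
      = D.cwyCenterOfMass (fun t => quadForm (cb t)) k u + ∑ j, c u k j * D.momentum j u
        - ∫ x, X k x * quadForm (c u) x * D.m u x ∂area := by
  have hm := D.smooth_mass hu
  have hq := smooth_quadForm (c u)
  have hgrad (x : S2) : D.m u x * grad (quadForm (c u)) x k
      = 2 * (D.m u x * ∑ j, c u k j * X j x) - 2 * (X k x * (quadForm (c u) x * D.m u x)) := by
    rw [(hasGrad_quadForm (c u)).grad_eq, (h.quad_c u hu).isSymm.eq]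
    simp only [Matrix.mulVec, dotProduct, Matrix.add_apply, add_mul, Finset.sum_add_distrib]
    ring
  rw [D.cwyCenterOfMassGeneral_eq hu (h.isSTF_shear hu) k hq (h.quad_cb u hu).isModeTwo_quadForm,
    D.sum_mul_momentum hu (c u k)]
  simp only [hgrad, mul_assoc]
  rw [integral_sub (SmoothOnSphere.integrable (by fun_prop))
    (SmoothOnSphere.integrable (by fun_prop)), integral_const_mul, integral_const_mul]
  ring

include hmh

theorem integral_mul_m {g : S2 → ℝ} (hg : IsHarmonicOfMode 2 g) :
    ∫ x, g x * D.m u x ∂area = ∫ x, g x * quadForm (mh u) x ∂area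
      + 3 * ∫ x, g x * quadForm (c u) x ∂area := by
  have hm := D.smooth_mass hu
  have hgs := hg.1
  have hq := smooth_quadForm
  have hdiv : SmoothOnSphere (div1 (div2 (D.shear u))) :=
    .div1 (isOneForm_div2 (h.isSTF_shear hu).smooth).smooth
  have hsplit (x : S2) : (D.modifiedMass u x - quadForm (mh u) x) * g x
      = g x * D.m u x - 1 / 4 * (g x * div1 (div2 (D.shear u)) x) - g x * quadForm (mh u) x := by
    rw [NullInfinityData.modifiedMass]
    ring
  have horth := (hmh u hu).2.2 g hg
  simp only [hsplit] at horth
  rw [integral_sub (SmoothOnSphere.integrable (by fun_prop))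
    (SmoothOnSphere.integrable (by fun_prop)), integral_sub
    (SmoothOnSphere.integrable (by fun_prop)) (SmoothOnSphere.integrable (by fun_prop)),
    integral_const_mul, h.shear_eq u hu, integral_mul_div1_div2_shearTensor hgs
      (h.quad_c u hu).isModeTwo_quadForm (h.quad_cb u hu).isModeTwo_quadForm] at horth
  linarith

theorem modeTwo_eq (l : Fin 3) : mh u k l
    = 15 / (8 * Real.pi) * ∫ x, quadForm (traceFreeUnit k l) x * D.m u x ∂area - 3 * c u k l := by
  have hT := isQuadrupole_traceFreeUnit k l
  have hc := h.quad_c u hu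
  rw [h.integral_mul_m hu hmh (isHarmonicOfMode_quadForm hT.trace_eq_zero),
    hT.integral_quadForm_mul, hT.integral_quadForm_mul, trace_traceFreeUnit_mul (hmh u hu).1,
    trace_traceFreeUnit_mul hc.isSymm, (hmh u hu).2.1, hc.trace_eq_zero]
  field [Real.pi_ne_zero]

theorem hasDerivWithinAt_modeTwo (l : Fin 3) :
    HasDerivWithinAt (fun t => mh t k l) (massModeRate (n u) (nb u) k l) I u := by
  have hT := isQuadrupole_traceFreeUnit k l
  have hn := h.quad_n hu
  have hnb := h.quad_nb hu
  have hq := smooth_quadForm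
  have hmass := h.hasDerivWithinAt_integral_mul_m hu (smooth_quadForm (traceFreeUnit k l))
  refine (((hmass.const_mul (15 / (8 * Real.pi))).sub ((h.deriv_c u hu k l).const_mul 3)
    ).congr_of_mem (fun t ht => h.modeTwo_eq ht hmh k l) hu).congr_deriv ?_
  rw [h.news_eq hu, integral_mul_inner2_shearTensor_self hT.isModeTwo_quadForm
    hn.isModeTwo_quadForm hnb.isModeTwo_quadForm, hT.integral_quadForm_mul,
    trace_traceFreeUnit_mul hn.isSymm, hn.trace_eq_zero, massModeRate_eq hn.isSymm hnb.isSymm]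
  simp only [mul_add]
  rw [integral_add (SmoothOnSphere.integrable (by fun_prop))
    (SmoothOnSphere.integrable (by fun_prop)), hT.integral_quadForm_mul_sq hn,
    hT.integral_quadForm_mul_sq hnb, Matrix.trace_add]
  field [Real.pi_ne_zero]

theorem rotPairing_quadForm_m {B : Matrix (Fin 3) (Fin 3) ℝ} (hB : IsQuadrupole B) :
    rotPairing k (quadForm B) (D.m u) = 16 * Real.pi / 15 *
      (epsContract B (mh u) k + 3 * epsContract B (c u) k) := by
  have hswap (f : S2 → ℝ) : rotPairing k f (quadForm B)
      = ∫ x, rotDeriv k (quadForm B) x * f x ∂area := by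
    simp only [rotPairing, mul_comm]
  rw [rotPairing_antisymm k (smooth_quadForm B) (D.smooth_mass hu), hswap,
    h.integral_mul_m hu hmh (isHarmonicOfMode_rotDeriv_quadForm hB.isSymm k), ← hswap, ← hswap,
    rotPairing_antisymm k (smooth_quadForm _) (smooth_quadForm B),
    rotPairing_antisymm k (smooth_quadForm (c u)) (smooth_quadForm B),
    hB.rotPairing_quadForm k (hmh u hu).1, hB.rotPairing_quadForm k (h.quad_c u hu).isSymm]
  ring

theorem cwyAngularMomentum_eq : D.cwyAngularMomentum (fun t => quadForm (c t)) k u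
    = D.classicalAngularMomentum k u - 16 * Real.pi / 15 * epsContract (c u) (mh u) k := by
  have hc := h.quad_c u hu
  rw [D.cwyAngularMomentum_eq hu (h.isSTF_shear hu) k (smooth_quadForm _),
    h.rotPairing_quadForm_m hu hmh k hc]
  linear_combination -(8 * Real.pi / 5) * epsContract_antisymm hc.isSymm hc.isSymm k

theorem cwyCenterOfMass_eq : D.cwyCenterOfMass (fun t => quadForm (cb t)) k u
    = D.classicalCenterOfMass k u
      + 32 * Real.pi / 15 * (epsContract (cb u) (mh u) k + 3 * epsContract (cb u) (c u) k) := by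
  rw [D.cwyCenterOfMass_eq hu (h.isSTF_shear hu) k (smooth_quadForm _),
    h.rotPairing_quadForm_m hu hmh k (h.quad_cb u hu)]
  ring

theorem hasDerivWithinAt_cwyAngularMomentum :
    HasDerivWithinAt (D.cwyAngularMomentum (fun t => quadForm (c t)) k)
      (16 * Real.pi / 15 * (3 * epsContract (c u) (n u) k + 3 * epsContract (cb u) (nb u) k
        - epsContract (n u) (mh u) k - epsContract (c u) (massModeRate (n u) (nb u)) k)) I u := by
  have hmode := h.hasDerivWithinAt_modeTwo hu hmh
  refine (((h.hasDerivWithinAt_classicalAngularMomentum hu k).sub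
    ((hasDerivWithinAt_epsContract (h.deriv_c u hu) hmode k).const_mul
      (16 * Real.pi / 15))).congr_of_mem
        (fun t ht => h.cwyAngularMomentum_eq ht hmh k) hu).congr_deriv ?_
  ring

theorem hasDerivWithinAt_cwyCenterOfMass :
    HasDerivWithinAt (D.cwyCenterOfMass (fun t => quadForm (cb t)) k)
      (16 * Real.pi / 15 * (2 * epsContract (nb u) (mh u) k
        + 2 * epsContract (cb u) (massModeRate (n u) (nb u)) k
        + 6 * epsContract (nb u) (c u) k + 6 * epsContract (cb u) (n u) k)
        + 32 * u * Real.pi / 15 * epsContract (n u) (nb u) k) I u := by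
  have hmode := h.hasDerivWithinAt_modeTwo hu hmh
  have hcross := ((hasDerivWithinAt_epsContract (h.deriv_cb u hu) hmode k).add
    ((hasDerivWithinAt_epsContract (h.deriv_cb u hu) (h.deriv_c u hu) k).const_mul 3)).const_mul
      (32 * Real.pi / 15)
  refine (((h.hasDerivWithinAt_classicalCenterOfMass hu k).add hcross).congr_of_mem
    (fun t ht => h.cwyCenterOfMass_eq ht hmh k) hu).congr_deriv ?_
  ring

end HasQuadrupoleShear

end NullInfinity

end

theorem mainTheorem9 (I : Set ℝ) (hI : I.OrdConnected) (hI' : I.Nontrivial)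
    (D : NullInfinity.NullInfinityData I)
    (c cb n nb mh : ℝ → Matrix (Fin 3) (Fin 3) ℝ)
    (hc : ∀ u ∈ I, (c u).IsSymm ∧ (c u).trace = 0)
    (hcb : ∀ u ∈ I, (cb u).IsSymm ∧ (cb u).trace = 0)
    (hC : ∀ u ∈ I, ∀ x a b, D.shear u x a b =
      NullInfinity.closedPart (NullInfinity.quadForm (c u)) x a b
        + NullInfinity.coclosedPart (NullInfinity.quadForm (cb u)) x a b)
    (hn : ∀ u ∈ I, ∀ i j, HasDerivWithinAt (fun t => c t i j) (n u i j) I u)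
    (hnb : ∀ u ∈ I, ∀ i j, HasDerivWithinAt (fun t => cb t i j) (nb u i j) I u)
    (hmh : ∀ u ∈ I, NullInfinity.IsModeTwoPart (D.modifiedMass u) (mh u)) :
    ∀ u ∈ I,
      -- energy and linear momentum
      HasDerivWithinAt D.energy
        (-(8 * Real.pi / 5) * (NullInfinity.sqNorm (n u) + NullInfinity.sqNorm (nb u))) I u ∧
      (∀ k, HasDerivWithinAt (D.momentum k)
        (-(32 * Real.pi / 15) * NullInfinity.epsContract (n u) (nb u) k) I u) ∧
      -- classical angular momentum and center of mass
      (∀ k, HasDerivWithinAt (D.classicalAngularMomentum k)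
        (16 * Real.pi / 5 * (NullInfinity.epsContract (c u) (n u) k
          + NullInfinity.epsContract (cb u) (nb u) k)) I u) ∧
      (∀ k, HasDerivWithinAt (D.classicalCenterOfMass k)
        (32 * u * Real.pi / 15 * NullInfinity.epsContract (n u) (nb u) k) I u) ∧
      -- the mode-two part of the modified mass aspect
      (∀ k l, HasDerivWithinAt (fun t => mh t k l)
        (NullInfinity.massModeRate (n u) (nb u) k l) I u) ∧
      -- Chen-Wang-Yau angular momentum and center of mass
      (∀ k, HasDerivWithinAt
        (D.cwyAngularMomentum (fun t => NullInfinity.quadForm (c t)) k)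
        (16 * Real.pi / 15 * (3 * NullInfinity.epsContract (c u) (n u) k
          + 3 * NullInfinity.epsContract (cb u) (nb u) k
          - NullInfinity.epsContract (n u) (mh u) k
          - NullInfinity.epsContract (c u) (NullInfinity.massModeRate (n u) (nb u)) k)) I u) ∧
      (∀ k, HasDerivWithinAt
        (D.cwyCenterOfMass (fun t => NullInfinity.quadForm (cb t)) k)
        (16 * Real.pi / 15 * (2 * NullInfinity.epsContract (nb u) (mh u) k
          + 2 * NullInfinity.epsContract (cb u) (NullInfinity.massModeRate (n u) (nb u)) k
          + 6 * NullInfinity.epsContract (nb u) (c u) k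
          + 6 * NullInfinity.epsContract (cb u) (n u) k)
          + 32 * u * Real.pi / 15 * NullInfinity.epsContract (n u) (nb u) k) I u) ∧
      -- relation to the Chen-Wang-Yau center of mass for arbitrary potentials
      (∀ k, D.cwyCenterOfMassGeneral (fun t => NullInfinity.quadForm (c t))
          (fun t => NullInfinity.quadForm (cb t)) k u =
        D.cwyCenterOfMass (fun t => NullInfinity.quadForm (cb t)) k u
          + ∑ j, c u k j * D.momentum j u
          - ∫ x, NullInfinity.X k x * NullInfinity.quadForm (c u) x * D.m u x
              ∂NullInfinity.area) := by
  have h := NullInfinity.HasQuadrupoleShear.mk_of_potentials hI hI' hc hcb hC hn hnb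
  exact fun u hu => ⟨h.hasDerivWithinAt_energy hu, h.hasDerivWithinAt_momentum hu,
    h.hasDerivWithinAt_classicalAngularMomentum hu, h.hasDerivWithinAt_classicalCenterOfMass hu,
    h.hasDerivWithinAt_modeTwo hu hmh, h.hasDerivWithinAt_cwyAngularMomentum hu hmh,
    h.hasDerivWithinAt_cwyCenterOfMass hu hmh, h.cwyCenterOfMassGeneral_eq hu⟩
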